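/- Let $\mathcal A=\{r,y,b,g\}$ (red, yellow, blue, gray) and let $\mathcal A^{\mathbb Z^2}$ be the set of configurations $\omega:\mathbb Z^2\to\mathcal A$. Use on $\mathbb Z^2$ the distance $d(x,y)=\max(|x_1-y_1|,|x_2-y_2|)$ with open balls $B(0,r)$, and on $\mathcal A^{\mathbb Z^2}$ the metric $\inf\{\tfrac1{r+1}: r\ge 0,\ \omega|_{B(0,r)}=\rho|_{B(0,r)}\}$; let $\delta_H$ be the induced Hausdorff distance of sets of configurations, and $d_H$ the Hausdorff distance of sets of numbers. $\mathbb Z^2$ acts by $(\gamma\omega)(\eta)=\omega(\eta-\gamma)$, $\mathrm{Orb}(\omega)$ is the orbit of $\omega$, and $\omega$ is periodic if $\mathrm{Orb}(\omega)$ is finite. A subshift is a nonempty, closed, translation invariant set of configurations; it is periodically approximable if it is the $\delta_H$-limit of a sequence of finite orbits. A patch is a map $P:M\to\mathcal A$ with support $M\subseteq\mathbb Z^2$. $P\prec Q$ means that some translate of $P$ is a restriction of $Q$. $W(\omega)$ is the set of finite patches $P\prec\omega$, $W(\Omega)=\bigcup_{\omega\in\Omega}W(\omega)$, and $W(\Omega)_M$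 is the set of those patches in $W(\Omega)$ with support $M$. The table tiling substitution is the rule $S_0:\mathcal A\to\mathcal A^K$, $K=\{-1,0\}^2$, $$ r\mapsto\begin{matrix} g& r\\ y& r\end{matrix},\qquad b\mapsto\begin{matrix} b& g\\ b& y\end{matrix},\qquad g\mapsto\begin{matrix} r& b\\ g& g\end{matrix},\qquad y\mapsto\begin{matrix} y& y\\ r& b\end{matrix}$$ (the right column has first coordinate $0$, the top row has second coordinate $0$), extended letterwise to patches and configurations by $S(P)(2\gamma+k)=S_0(P(\gamma))(k)$, $k\in K$. A finite patch is legal if it is a subpatch of $S^n(a)$ for a letter $a$ (as a patch on $\{0\}$) and some $n\ge1$, and $\Omega(S)$ is the set of configurations $\omega$ such that all patches in $W(\omega)$ are legal. Let $\omega_{rb}(\gamma)=r$ if $\gamma_1,\gamma_2$ have equal parity and $b$ otherwise; let $\omega_{gy}(\gamma)=g$ if $\gamma_1,\gamma_2$ have equal parity and $y$ otherwise. Let $C_{LR}$ be the linear repetitivity constant of $\Omega(S)$: the smallest $C\ge1$ such that for all real $r\ge1$ and $R\ge Cr$, all $P\in W(\Omega(S))_{B(0,R)}$ and all $Q\in W(\Omega(S))_{B(0,r)}$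 one has $Q\prec P$. A Schrödinger operator $H$ with finite range is given by a finite set $B=-B\subset\mathbb Z^2$ and continuous $t_\eta:\mathcal A^{\mathbb Z^2}\to\mathbb C$, $\eta\in B$, with $t_\eta(\omega)=\overline{t_{-\eta}((-\eta)\omega)}$. It defines the bounded self-adjoint operators $(H_\omega\psi)(\gamma)=\sum_{\eta\in B}t_\eta((-\gamma)\omega)\,\psi(\gamma+\eta)$ on $\ell^2(\mathbb Z^2)$. It is strongly pattern equivariant if each $t_\eta$ takes only finitely many values. Then: 1. $\Omega(S)$ is a subshift, and it is periodically approximable. The orbits of $\omega_{rb}$ and $\omega_{gy}$ have exactly two elements, all $S^n(\omega_{rb})$ and $S^n(\omega_{gy})$ are periodic, and $\lim_{n\to\infty}\mathrm{Orb}(S^n(\omega_{rb}))=\Omega(S)=\lim_{n\to\infty}\mathrm{Orb}(S^n(\omega_{gy}))$ with respect to $\delta_H$. 2. The smallest constant $C_{LR}$ exists, and for $i\in\{rb,gy\}$ and all integers $n\ge\log(2C_{LR})/\log 2$, $$\delta_H\big(\mathrm{Orb}(S^n(\omega_i)),\Omega(S)\big)\le\frac{\max\{2C_{LR},4\}}{2^n}.$$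 3. For each strongly pattern equivariant Schrödinger operator $H$ with finite range there is a constant $C_H>0$, depending only on $H$, such that for $i\in\{rb,gy\}$, all $\omega\in\Omega(S)$ and all integers $n\ge\log(2C_{LR})/\log 2$, $$d_H\big(\sigma(H_{S^n(\omega_i)}),\sigma(H_\omega)\big)\le C_H\,\frac{\max\{2C_{LR},4\}}{2^n}.$$ -/

import Mathlib

open Filter Topology

namespace TableTiling

/-! ### Configurations and patches over `ℤ²` -/

/-- The configuration space `𝒜^{ℤ²}`. -/
def Config (A : Type) : Type := ℤ × ℤ → A

namespace Config

variable {A : Type}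

/-- Two configurations agree on the open ball of radius `r` around the origin of `ℤ²`.
The distance of `ℤ × ℤ` is the maximum distance `max (|x₁ - y₁|, |x₂ - y₂|)`. -/
def Agree (ω ρ : Config A) (r : ℝ) : Prop :=
  ∀ x ∈ Metric.ball (0 : ℤ × ℤ) r, ω x = ρ x

/-- The set of all `1 / (r + 1)` with `r ≥ 0` such that `ω` and `ρ` agree on `B(0, r)`. -/
def agreeSet (ω ρ : Config A) : Set ℝ := {s | ∃ r : ℝ, 0 ≤ r ∧ Agree ω ρ r ∧ s = 1 / (r + 1)}

theorem agreeSet_bddBelow (ω ρ : Config A) : BddBelow (agreeSet ω ρ) := by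
  refine ⟨0, ?_⟩
  rintro s ⟨r, hr, -, rfl⟩
  positivity

theorem agreeSet_nonempty (ω ρ : Config A) : (agreeSet ω ρ).Nonempty :=
  ⟨1 / (0 + 1), 0, le_rfl, fun x hx => by simp at hx, rfl⟩

theorem Agree.comm {ω ρ : Config A} {r : ℝ} (h : Agree ω ρ r) : Agree ρ ω r :=
  fun x hx => (h x hx).symm

theorem agreeSet_comm (ω ρ : Config A) : agreeSet ω ρ = agreeSet ρ ω := by
  ext s
  constructor <;> rintro ⟨r, hr, h, rfl⟩ <;> exact ⟨r, hr, h.comm, rfl⟩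

/-- The distance `inf {1 / (r + 1) | r ≥ 0, ω = ρ on B(0, r)}`. -/
noncomputable instance : Dist (Config A) := ⟨fun ω ρ => sInf (agreeSet ω ρ)⟩

theorem dist_def (ω ρ : Config A) : dist ω ρ = sInf (agreeSet ω ρ) := rfl

theorem dist_le_of_agree {ω ρ : Config A} {r : ℝ} (hr : 0 ≤ r) (h : Agree ω ρ r) :
    dist ω ρ ≤ 1 / (r + 1) :=
  csInf_le (agreeSet_bddBelow ω ρ) ⟨r, hr, h, rfl⟩

theorem zero_le_dist (ω ρ : Config A) : 0 ≤ dist ω ρ := by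
  refine Real.sInf_nonneg ?_
  rintro s ⟨r, hr, -, rfl⟩
  positivity

theorem dist_le_max (ω ρ σ : Config A) : dist ω σ ≤ max (dist ω ρ) (dist ρ σ) := by
  refine le_of_forall_pos_lt_add fun ε hε => ?_
  obtain ⟨s, ⟨r, hr, h, rfl⟩, hs⟩ := exists_lt_of_csInf_lt (agreeSet_nonempty ω ρ)
    (show sInf (agreeSet ω ρ) < max (dist ω ρ) (dist ρ σ) + ε by
      have := le_max_left (dist ω ρ) (dist ρ σ)
      rw [← dist_def]; linarith)
  obtain ⟨s', ⟨r', hr', h', rfl⟩, hs'⟩ := exists_lt_of_csInf_lt (agreeSet_nonempty ρ σ)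
    (show sInf (agreeSet ρ σ) < max (dist ω ρ) (dist ρ σ) + ε by
      have := le_max_right (dist ω ρ) (dist ρ σ)
      rw [← dist_def]; linarith)
  have key : Agree ω σ (min r r') := fun x hx =>
    (h x (Metric.ball_subset_ball (min_le_left _ _) hx)).trans
      (h' x (Metric.ball_subset_ball (min_le_right _ _) hx))
  refine (dist_le_of_agree (le_min hr hr') key).trans_lt ?_
  rcases min_choice r r' with hm | hm <;> rw [hm] <;> assumption

noncomputable instance : MetricSpace (Config A) where
  dist_self ω := by
    refine le_antisymm (le_of_forall_pos_lt_add fun ε hε => ?_) (zero_le_dist ω ω)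
    obtain ⟨n, hn⟩ := exists_nat_one_div_lt hε
    have := dist_le_of_agree (ω := ω) (ρ := ω) (Nat.cast_nonneg n) (fun x _ => rfl)
    linarith
  dist_comm ω ρ := by rw [dist_def, dist_def, agreeSet_comm]
  dist_triangle ω ρ σ := (dist_le_max ω ρ σ).trans
    (max_le_add_of_nonneg (zero_le_dist _ _) (zero_le_dist _ _))
  eq_of_dist_eq_zero := by
    intro ω ρ h
    funext x
    by_contra hx
    have : 1 / (dist x 0 + 1) ≤ dist ω ρ := by
      refine le_csInf (agreeSet_nonempty ω ρ) ?_
      rintro s ⟨r, hr, hag, rfl⟩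
      have : r ≤ dist x 0 := by
        by_contra hlt
        exact hx (hag x (by simpa using hlt))
      gcongr
    rw [h] at this
    have h2 : (0 : ℝ) < 1 / (dist x 0 + 1) := by positivity
    linarith

/-- For a finite alphabet the configuration space is compact. -/
instance [Finite A] : CompactSpace (Config A) := by
  let _ : TopologicalSpace A := ⊥
  have _ : DiscreteTopology A := ⟨rfl⟩
  let f : (ℤ × ℤ → A) → Config A := fun ω => ω
  have hf : Continuous f := by
    rw [continuous_iff_continuousAt]
    intro ω
    rw [ContinuousAt, Metric.tendsto_nhds]
    intro ε hε
    obtain ⟨n, hn⟩ := exists_nat_one_div_lt hε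
    have hfin : (Metric.ball (0 : ℤ × ℤ) n).Finite :=
      (Metric.isCompact_of_isClosed_isBounded Metric.isClosed_closedBall
        Metric.isBounded_closedBall).finite_of_discrete.subset Metric.ball_subset_closedBall
    have hev : ∀ᶠ ρ in 𝓝 ω, ∀ x ∈ Metric.ball (0 : ℤ × ℤ) n, ρ x = ω x := by
      rw [Filter.eventually_all_finite hfin]
      intro x _
      have : Tendsto (fun ρ : ℤ × ℤ → A => ρ x) (𝓝 ω) (𝓝 (ω x)) :=
        (continuous_apply x).continuousAt
      exact this ((isOpen_discrete {ω x}).mem_nhds rfl)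
    filter_upwards [hev] with ρ hρ
    exact (dist_le_of_agree (Nat.cast_nonneg n) hρ).trans_lt hn
  have : Set.range f = Set.univ := Set.range_eq_univ.2 fun ω => ⟨ω, rfl⟩
  exact ⟨this ▸ isCompact_range hf⟩

/-- The translation action `(γ ω)(η) = ω(η - γ)` of `ℤ²`. -/
def translate (γ : ℤ × ℤ) (ω : Config A) : Config A := fun η => ω (-γ + η)

/-- The orbit of a configuration. -/
def orbit (ω : Config A) : Set (Config A) := Set.range fun γ => translate γ ω

/-- A configuration is periodic if its orbit is finite. -/
def IsPeriodic (ω : Config A) : Prop := (orbit ω).Finite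

end Config

variable {A : Type}

/-- Subshifts: nonempty closed translation invariant sets of configurations. -/
def IsSubshift (Ω : Set (Config A)) : Prop :=
  Ω.Nonempty ∧ IsClosed Ω ∧ ∀ γ, ∀ ω ∈ Ω, Config.translate γ ω ∈ Ω

/-- Some sequence of finite orbits converges to `Ω` in the Hausdorff metric. -/
def IsPeriodicallyApproximable (Ω : Set (Config A)) : Prop :=
  ∃ ω : ℕ → Config A, (∀ n, (ω n).IsPeriodic) ∧
    Tendsto (fun n => Metric.hausdorffDist (ω n).orbit Ω) atTop (𝓝 0)

/-- A patch is a partial function from `ℤ²` to the alphabet; `none` means "not in the support". -/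
abbrev Patch (A : Type) : Type := ℤ × ℤ → Option A

/-- The support of a patch. -/
def Patch.support (P : Patch A) : Set (ℤ × ℤ) := {x | P x ≠ none}

/-- `P ≺ Q`: some translate of `P` is a restriction of `Q`. -/
def Patch.IsSubpatch (P Q : Patch A) : Prop :=
  ∃ γ : ℤ × ℤ, ∀ (η : ℤ × ℤ) (a : A), P η = some a → Q (γ + η) = some a

/-- A configuration, seen as a patch with full support. -/
def Config.toPatch (ω : Config A) : Patch A := fun x => some (ω x)

/-- The dictionary `W(ω)`: all finite subpatches of `ω`. -/
def dict (ω : Config A) : Set (Patch A) := {P | P.support.Finite ∧ P.IsSubpatch ω.toPatch}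

/-- `W(Ω)_M`: the patches with support `M` in the dictionary of `Ω`. -/
def dictOn (Ω : Set (Config A)) (M : Set (ℤ × ℤ)) : Set (Patch A) :=
  {P | P.support = M ∧ ∃ ω ∈ Ω, P ∈ dict ω}

/-- All constants `C ≥ 1` such that for all `r ≥ 1` and `R ≥ C r`, every patch of `Ω` supported
on `B(0, R)` contains every patch of `Ω` supported on `B(0, r)`. -/
def repetitivityConstants (Ω : Set (Config A)) : Set ℝ :=
  {C | 1 ≤ C ∧ ∀ r R : ℝ, 1 ≤ r → C * r ≤ R →
    ∀ P ∈ dictOn Ω (Metric.ball 0 R), ∀ Q ∈ dictOn Ω (Metric.ball 0 r), Q.IsSubpatch P}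

/-- The linear repetitivity constant of `Ω`. -/
noncomputable def linRepConst (Ω : Set (Config A)) : ℝ := sInf (repetitivityConstants Ω)

/-! ### The table tiling substitution -/

/-- The alphabet. Under the usual coding of the table tiling, `red` and `blue` are the left and
right halves of a horizontal domino, `gray` and `yellow` the top and bottom halves of a vertical
domino. -/
inductive Letter : Type
  | red | yellow | blue | gray

instance : Finite Letter :=
  Finite.of_surjective
    (fun i : Fin 4 => match i with
      | 0 => Letter.red | 1 => Letter.yellow | 2 => Letter.blue | 3 => Letter.gray)
    (by
      intro a
      cases a
      exacts [⟨0, rfl⟩, ⟨1, rfl⟩, ⟨2, rfl⟩, ⟨3, rfl⟩])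

/-- The `2 × 2` block with rows `tl tr` (second coordinate `0`) and `bl br` (second coordinate
`-1`), as a function on `K = {-1, 0}²`; the left column has first coordinate `-1`. -/
def block (tl tr bl br : Letter) (k : ℤ × ℤ) : Letter :=
  if k.2 = 0 then (if k.1 = 0 then tr else tl) else (if k.1 = 0 then br else bl)

/-- The substitution rule `S₀ : 𝒜 → 𝒜^K`; only its values at `k ∈ K = {-1, 0}²` matter. -/
def rule : Letter → ℤ × ℤ → Letter
  | .red => block
      .gray   .red
      .yellow .red
  | .blue => block
      .blue .gray
      .blue .yellow
  | .gray => block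
      .red  .blue
      .gray .gray
  | .yellow => block
      .yellow .yellow
      .red    .blue

/-- The set `K = {-1, 0}²`. -/
def K : Set (ℤ × ℤ) := {-1, 0} ×ˢ {-1, 0}

/-- For `x ∈ ℤ²`, the unique `γ ∈ ℤ²` with `x ∈ 2 γ + K`. -/
def parent (x : ℤ × ℤ) : ℤ × ℤ := ((x.1 + 1) / 2, (x.2 + 1) / 2)

/-- For `x ∈ ℤ²`, the position `x - 2 γ ∈ K` of `x` in its block. -/
def position (x : ℤ × ℤ) : ℤ × ℤ := x - 2 • parent x

theorem position_mem (x : ℤ × ℤ) : position x ∈ K := by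
  obtain ⟨a, b⟩ := x
  simp only [position, parent, K, Set.mem_prod, Set.mem_insert_iff, Set.mem_singleton_iff,
    Prod.fst_sub, Prod.snd_sub, two_nsmul, Prod.fst_add, Prod.snd_add]
  omega

theorem parent_position_unique (γ : ℤ × ℤ) {k : ℤ × ℤ} (hk : k ∈ K) :
    parent (2 • γ + k) = γ ∧ position (2 • γ + k) = k := by
  obtain ⟨a, b⟩ := γ
  obtain ⟨c, d⟩ := k
  simp only [K, Set.mem_prod, Set.mem_insert_iff, Set.mem_singleton_iff] at hk
  simp only [position, parent, Prod.ext_iff, Prod.fst_sub, Prod.snd_sub, two_nsmul,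
    Prod.fst_add, Prod.snd_add]
  omega

/-- The substitution map on configurations: `S(ω)(2 γ + k) = S₀(ω(γ))(k)` for `k ∈ K`. -/
def subst (ω : Config Letter) : Config Letter := fun x => rule (ω (parent x)) (position x)

/-- The substitution map on patches: a patch with support `M` is sent to the patch with support
`2 M + K` whose value at `2 γ + k` is `S₀(P(γ))(k)`. -/
def substPatch (P : Patch Letter) : Patch Letter := fun x =>
  (P (parent x)).map fun a => rule a (position x)

/-- A letter, as a patch with support `{0}`. -/
def letterPatch (a : Letter) : Patch Letter := fun x => if x = 0 then some a else none

/-- The set `W(S)` of `S`-legal patches. -/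
def legalPatches : Set (Patch Letter) :=
  {P | P.support.Finite ∧ ∃ n : ℕ, 1 ≤ n ∧ ∃ a, P.IsSubpatch (substPatch^[n] (letterPatch a))}

/-- The table tiling subshift `Ω(S)`. -/
def tableSubshift : Set (Config Letter) := {ω | dict ω ⊆ legalPatches}

/-- The checkerboard with letter `a` on `(2ℤ)² ∪ ((1, 1) + (2ℤ)²)` and `b` elsewhere. -/
def checkerboard (a b : Letter) : Config Letter := fun x =>
  if (Even x.1 ∧ Even x.2) ∨ (Odd x.1 ∧ Odd x.2) then a else b

/-- The configuration `ω_rb`. -/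
def omegaRB : Config Letter := checkerboard .red .blue

/-- The configuration `ω_gy`. -/
def omegaGY : Config Letter := checkerboard .gray .yellow

/-! ### Schrödinger operators with finite range -/

/-- The Hilbert space `ℓ²(ℤ²)`. -/
abbrev L2 : Type := lp (fun _ : ℤ × ℤ => ℂ) 2

theorem memlp_weighted (c : ℤ × ℤ → ℂ) (M : ℝ) (hM : ∀ γ, ‖c γ‖ ≤ M) (η : ℤ × ℤ) (ψ : L2) :
    Memℓp (fun γ => c γ * ψ (γ + η)) 2 ∧
      ∑' γ, ‖c γ * ψ (γ + η)‖ ^ (2 : ℝ) ≤ (M * ‖ψ‖) ^ (2 : ℝ) := by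
  have h0 : 0 ≤ M := (norm_nonneg _).trans (hM 0)
  have h2 : (0 : ℝ) < (2 : ENNReal).toReal := by norm_num
  have hs : HasSum (fun γ => ‖ψ γ‖ ^ (2 : ℝ)) (‖ψ‖ ^ (2 : ℝ)) := by
    simpa using lp.hasSum_norm h2 ψ
  have hs' : HasSum (fun γ => M ^ (2 : ℝ) * ‖ψ (γ + η)‖ ^ (2 : ℝ))
      (M ^ (2 : ℝ) * ‖ψ‖ ^ (2 : ℝ)) :=
    ((Equiv.addRight η).hasSum_iff.2 hs).mul_left _
  have hle : ∀ γ, ‖c γ * ψ (γ + η)‖ ^ (2 : ℝ) ≤ M ^ (2 : ℝ) * ‖ψ (γ + η)‖ ^ (2 : ℝ) := by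
    intro γ
    rw [← Real.mul_rpow h0 (norm_nonneg _), norm_mul]
    gcongr
    exact hM γ
  have hsum : Summable fun γ => ‖c γ * ψ (γ + η)‖ ^ (2 : ℝ) :=
    hs'.summable.of_nonneg_of_le (fun γ => by positivity) hle
  refine ⟨memℓp_gen (by simpa using hsum), ?_⟩
  rw [Real.mul_rpow h0 (norm_nonneg _), ← hs'.tsum_eq]
  exact hsum.tsum_le_tsum hle hs'.summable

/-- The bounded operator `(T ψ)(γ) = c(γ) ψ(γ + η)` on `ℓ²(ℤ²)` for a bounded function `c`. -/
noncomputable def weightedShift (c : ℤ × ℤ → ℂ) (hc : ∃ M : ℝ, ∀ γ, ‖c γ‖ ≤ M) (η : ℤ × ℤ) :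
    L2 →L[ℂ] L2 :=
  LinearMap.mkContinuousOfExistsBound
    { toFun := fun ψ => ⟨fun γ => c γ * ψ (γ + η),
        (memlp_weighted c hc.choose hc.choose_spec η ψ).1⟩
      map_add' := by
        intro φ ψ
        ext γ
        change c γ * (φ (γ + η) + ψ (γ + η)) = c γ * φ (γ + η) + c γ * ψ (γ + η)
        ring
      map_smul' := by
        intro z ψ
        ext γ
        change c γ * (z * ψ (γ + η)) = z * (c γ * ψ (γ + η))
        ring }
    (by
      obtain ⟨M, hM⟩ := hc
      have h0 : 0 ≤ M := (norm_nonneg _).trans (hM 0)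
      refine ⟨M, fun ψ => lp.norm_le_of_tsum_le (by norm_num) (by positivity) ?_⟩
      simpa using (memlp_weighted c M hM η ψ).2)

/-- A Schrödinger operator with finite range over `𝒜^{ℤ²}`: a finite set `B = -B` and continuous
coefficients `t_η`, `η ∈ B`, with the symmetry that makes all `H_ω` self-adjoint. -/
structure FiniteRangeOperator (A : Type) where
  B : Finset (ℤ × ℤ)
  neg_mem : ∀ η ∈ B, -η ∈ B
  t : ℤ × ℤ → Config A → ℂ
  continuous_t : ∀ η ∈ B, Continuous (t η)
  symm_t : ∀ η ∈ B, ∀ ω, t η ω = (starRingEnd ℂ) (t (-η) (Config.translate (-η) ω))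

namespace FiniteRangeOperator

theorem exists_bound [Finite A] (H : FiniteRangeOperator A) (ω : Config A) {η : ℤ × ℤ}
    (hη : η ∈ H.B) : ∃ M : ℝ, ∀ γ, ‖H.t η (Config.translate (-γ) ω)‖ ≤ M := by
  obtain ⟨M, hM⟩ := isCompact_univ.exists_bound_of_continuousOn (H.continuous_t η hη).continuousOn
  exact ⟨M, fun γ => hM _ (Set.mem_univ _)⟩

/-- The operator `H_ω` on `ℓ²(ℤ²)`. -/
noncomputable def op [Finite A] (H : FiniteRangeOperator A) (ω : Config A) : L2 →L[ℂ] L2 :=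
  ∑ η ∈ H.B.attach,
    weightedShift (fun γ => H.t η (Config.translate (-γ) ω)) (H.exists_bound ω η.2) η

/-- The defining formula `(H_ω ψ)(γ) = ∑_{η ∈ B} t_η(γ⁻¹ ω) ψ(γ + η)`. -/
theorem op_apply [Finite A] (H : FiniteRangeOperator A) (ω : Config A) (ψ : L2) (γ : ℤ × ℤ) :
    H.op ω ψ γ = ∑ η ∈ H.B, H.t η (Config.translate (-γ) ω) * ψ (γ + η) := by
  have hsum : H.op ω ψ γ = ∑ η ∈ H.B.attach,
      H.t η (Config.translate (-γ) ω) * ψ (γ + (η : ℤ × ℤ)) := by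
    rw [op, sum_apply, lp.coeFn_sum, Finset.sum_apply]
    rfl
  rw [hsum, Finset.sum_attach H.B fun η => H.t η (Config.translate (-γ) ω) * ψ (γ + η)]

/-- The operators `H_ω` are self-adjoint. -/
theorem op_isSelfAdjoint [Finite A] (H : FiniteRangeOperator A) (ω : Config A) :
    IsSelfAdjoint (H.op ω) := by
  rw [ContinuousLinearMap.isSelfAdjoint_iff_isSymmetric]
  intro φ ψ
  have key : ∀ (η : ℤ × ℤ) (hη : η ∈ H.B),
      inner ℂ (weightedShift _ (H.exists_bound ω hη) η φ) ψ =
        inner ℂ φ (weightedShift _ (H.exists_bound ω (H.neg_mem η hη)) (-η) ψ) := by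
    intro η hη
    rw [lp.inner_eq_tsum, lp.inner_eq_tsum, ← (Equiv.addRight (-η)).tsum_eq]
    refine tsum_congr fun γ => ?_
    have hs := H.symm_t (-η) (H.neg_mem η hη) (Config.translate (-γ) ω)
    have ht : Config.translate (-(-η)) (Config.translate (-γ) ω) =
        Config.translate (-(γ + -η)) ω := by
      funext x
      simp only [Config.translate]
      congr 1
      abel
    rw [ht, neg_neg] at hs
    change ψ (γ + -η) * (starRingEnd ℂ) (H.t η (Config.translate (-(γ + -η)) ω) *
        φ (γ + -η + η)) =
      H.t (-η) (Config.translate (-γ) ω) * ψ (γ + -η) * (starRingEnd ℂ) (φ γ)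
    rw [hs, neg_add_cancel_right, map_mul]
    ring
  change inner ℂ (H.op ω φ) ψ = inner ℂ φ (H.op ω ψ)
  rw [op, sum_apply, sum_apply, sum_inner, inner_sum]
  refine Finset.sum_bij' (fun η _ => ⟨-η.1, H.neg_mem _ η.2⟩) (fun η _ => ⟨-η.1, H.neg_mem _ η.2⟩)
    (by simp) (by simp) (by simp) (by simp) fun η _ => key η.1 η.2

/-- Strong pattern equivariance: the (continuous) coefficients take finitely many values. -/
def IsStronglyPatternEquivariant (H : FiniteRangeOperator A) : Prop :=
  ∀ η ∈ H.B, (Set.range (H.t η)).Finite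

end FiniteRangeOperator

end TableTiling

/-! The subshift is governed by two facts about $S$. It is primitive: every letter occurs in
$S^2(c)$ for every letter $c$ (`letterPatch_isSubpatch_two`). And $S^n$ replaces a letter by a
$2^n\times 2^n$ block, so a patch of width about $2^j$ meets at most $2\times2$ blocks of level $j$
(`exists_window`). There are only finitely many legal $2\times2$ windows, so one exponent $k$ makes
all of them occur in $S^k(c)$ for every $c$. A legal patch of width about $2^j$ therefore occurs in
$S^{j+k}(c)$, while a legal patch on a ball of radius $2^n$ contains a whole $S^n(b)$. Together
these give minimality (`isSubpatch_of_legal_of_mem`) and linear repetitivity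
(`repetitivityConstants_nonempty`).

All $2\times2$ windows of the two checkerboards are legal. Hence small patches of $S^n(\omega_0)$
are legal and occur in each $\omega\in\Omega(S)$. Conversely $S^n(\omega_0)$ contains a block
$S^n(a)$, hence a legal patch on a ball of radius $2^{n-1}$, and repetitivity with constant $C$
finds in it all patches of radius $r\le 2^n/(2C)$. So $S^n(\omega_0)$ and $\omega$ have the same
patterns on balls of radius $2^n/(2C)$, which bounds the Hausdorff distance of the orbits.

For the spectra, equality of patterns at scale $r$ gives a distance $O(1/r)$. An approximate
eigenvector of $H_\omega$ is cut off by translated tents of width proportional to $r$. Averaging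
over all translates shows that some cutoff has error $O(1/r)$ (`exists_localized`). Finite range and
locality of the coefficients let the cutoff vector be moved to a place of the other configuration
with the same pattern (`exists_transported`), and for self-adjoint operators a small residual means
a nearby point of the spectrum. -/

namespace TableTiling

/-! ### Subpatches and iterated substitution -/

namespace Patch

variable {A : Type}

theorem IsSubpatch.refl (P : Patch A) : P.IsSubpatch P :=
  ⟨0, fun η a h => by simpa using h⟩

theorem IsSubpatch.trans {P Q R : Patch A} (h₁ : P.IsSubpatch Q) (h₂ : Q.IsSubpatch R) :
    P.IsSubpatch R := by
  obtain ⟨γ, hγ⟩ := h₁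
  obtain ⟨δ, hδ⟩ := h₂
  exact ⟨δ + γ, fun η a h => by rw [add_assoc]; exact hδ _ _ (hγ _ _ h)⟩

end Patch

theorem parent_two_smul_add (γ x : ℤ × ℤ) : parent (2 • γ + x) = γ + parent x := by
  obtain ⟨a, b⟩ := γ
  obtain ⟨c, d⟩ := x
  simp only [parent, Prod.ext_iff, two_nsmul, Prod.fst_add, Prod.snd_add]
  omega

theorem position_two_smul_add (γ x : ℤ × ℤ) : position (2 • γ + x) = position x := by
  simp only [position, parent_two_smul_add, smul_add]
  abel

/-- Because $K=\{-1,0\}^2$, the level-$n$ block of $\gamma$ is the half-open square of side $2^n$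
with upper right corner $2^n\gamma$. All later containments of balls and blocks reduce to these
inequalities. -/
theorem parent_iterate_eq_iff (n : ℕ) (x γ : ℤ × ℤ) :
    parent^[n] x = γ ↔
      (2 ^ n * γ.1 - 2 ^ n < x.1 ∧ x.1 ≤ 2 ^ n * γ.1) ∧
        (2 ^ n * γ.2 - 2 ^ n < x.2 ∧ x.2 ≤ 2 ^ n * γ.2) := by
  induction n generalizing x with
  | zero =>
    simp only [Function.iterate_zero, id_eq, Prod.ext_iff]
    omega
  | succ n ih =>
    rw [Function.iterate_succ_apply, ih]
    simp only [parent, pow_succ', mul_assoc]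
    generalize (2 : ℤ) ^ n * γ.1 = a
    generalize (2 : ℤ) ^ n * γ.2 = b
    generalize (2 : ℤ) ^ n = N
    omega

theorem two_pow_smul_fst (n : ℕ) (γ : ℤ × ℤ) : (2 ^ n • γ).1 = 2 ^ n * γ.1 := by
  rw [Prod.smul_fst, nsmul_eq_mul]
  push_cast
  rfl

theorem two_pow_smul_snd (n : ℕ) (γ : ℤ × ℤ) : (2 ^ n • γ).2 = 2 ^ n * γ.2 := by
  rw [Prod.smul_snd, nsmul_eq_mul]
  push_cast
  rfl

/-- Translation of a patch, moving `γ` to the origin. -/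
def Patch.shift {A : Type} (Q : Patch A) (γ : ℤ × ℤ) : Patch A := fun η => Q (γ + η)

open Classical in
/-- Restriction of a patch to a set of positions. -/
noncomputable def Patch.restrict {A : Type} (Q : Patch A) (M : Set (ℤ × ℤ)) : Patch A :=
  fun η => if η ∈ M then Q η else none

theorem Patch.shift_isSubpatch {A : Type} (Q : Patch A) (γ : ℤ × ℤ) :
    (Q.shift γ).IsSubpatch Q := ⟨γ, fun _ _ h => h⟩

theorem Patch.restrict_isSubpatch {A : Type} (Q : Patch A) (M : Set (ℤ × ℤ)) :
    (Q.restrict M).IsSubpatch Q := by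
  refine ⟨0, fun η a h => ?_⟩
  unfold Patch.restrict at h
  split_ifs at h
  simpa using h

theorem Patch.restrict_of_mem {A : Type} (Q : Patch A) {M : Set (ℤ × ℤ)} {x : ℤ × ℤ}
    (hx : x ∈ M) : Q.restrict M x = Q x := if_pos hx

theorem Patch.restrict_of_notMem {A : Type} (Q : Patch A) {M : Set (ℤ × ℤ)} {x : ℤ × ℤ}
    (hx : x ∉ M) : Q.restrict M x = none := if_neg hx

theorem Patch.support_restrict_subset {A : Type} (Q : Patch A) (M : Set (ℤ × ℤ)) :
    (Q.restrict M).support ⊆ M := by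
  intro x hx
  by_contra h
  exact hx (Q.restrict_of_notMem h)

theorem substPatch_iterate_succ (n : ℕ) (Q : Patch Letter) (x : ℤ × ℤ) :
    substPatch^[n + 1] Q x =
      (substPatch^[n] Q (parent x)).map fun a => rule a (position x) := by
  rw [Function.iterate_succ_apply']
  rfl

theorem substPatch_iterate_shift (n : ℕ) (Q : Patch Letter) (γ x : ℤ × ℤ) :
    substPatch^[n] (Q.shift γ) x = substPatch^[n] Q (2 ^ n • γ + x) := by
  induction n generalizing x with
  | zero => simp [Patch.shift]
  | succ n ih =>
    have h : 2 ^ (n + 1) • γ + x = 2 • (2 ^ n • γ) + x := by rw [pow_succ', mul_smul]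
    rw [substPatch_iterate_succ, substPatch_iterate_succ, ih, h, parent_two_smul_add,
      position_two_smul_add]

theorem substPatch_iterate_restrict_of_mem (n : ℕ) (Q : Patch Letter) {M : Set (ℤ × ℤ)}
    {x : ℤ × ℤ} (hx : parent^[n] x ∈ M) :
    substPatch^[n] (Q.restrict M) x = substPatch^[n] Q x := by
  induction n generalizing x with
  | zero => exact Q.restrict_of_mem hx
  | succ n ih =>
    rw [substPatch_iterate_succ, substPatch_iterate_succ, ih hx]

theorem substPatch_iterate_eq_none_iff (n : ℕ) (Q : Patch Letter) (x : ℤ × ℤ) :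
    substPatch^[n] Q x = none ↔ Q (parent^[n] x) = none := by
  induction n generalizing x with
  | zero => rfl
  | succ n ih =>
    rw [substPatch_iterate_succ, Option.map_eq_none_iff, ih, Function.iterate_succ_apply]

theorem Patch.IsSubpatch.substPatch {P Q : Patch Letter} (h : P.IsSubpatch Q) :
    (substPatch P).IsSubpatch (substPatch Q) := by
  obtain ⟨γ, hγ⟩ := h
  refine ⟨2 • γ, fun η a ha => ?_⟩
  simp only [TableTiling.substPatch, Option.map_eq_some_iff] at ha ⊢
  obtain ⟨b, hb, rfl⟩ := ha
  rw [parent_two_smul_add, position_two_smul_add]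
  exact ⟨b, hγ _ _ hb, rfl⟩

theorem Patch.IsSubpatch.substPatch_iterate {P Q : Patch Letter} (h : P.IsSubpatch Q) (n : ℕ) :
    (TableTiling.substPatch^[n] P).IsSubpatch (TableTiling.substPatch^[n] Q) := by
  induction n with
  | zero => exact h
  | succ n ih =>
    rw [Function.iterate_succ_apply', Function.iterate_succ_apply']
    exact ih.substPatch

theorem substPatch_iterate_toPatch (n : ℕ) (ω : Config Letter) :
    substPatch^[n] ω.toPatch = (subst^[n] ω).toPatch := by
  induction n with
  | zero => rfl
  | succ n ih =>
    rw [Function.iterate_succ_apply', Function.iterate_succ_apply', ih]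
    rfl

theorem letterPatch_isSubpatch {a : Letter} {Q : Patch Letter} {γ : ℤ × ℤ} (h : Q γ = some a) :
    (letterPatch a).IsSubpatch Q := by
  refine ⟨γ, fun η b hb => ?_⟩
  unfold letterPatch at hb
  split_ifs at hb with h0
  subst h0
  rw [add_zero, h, hb]

/-- Primitivity of $S$, by inspection of the sixteen cases. The second power is needed: $S_0(r)$,
for instance, contains no $b$. -/
theorem letterPatch_isSubpatch_two (a c : Letter) :
    (letterPatch a).IsSubpatch (substPatch^[2] (letterPatch c)) := by
  suffices h : ∃ γ, substPatch^[2] (letterPatch c) γ = some a from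
    h.elim fun γ hγ => letterPatch_isSubpatch hγ
  cases a <;> cases c <;> first
    | exact ⟨(0, 0), rfl⟩
    | exact ⟨(-1, 0), rfl⟩
    | exact ⟨(0, -1), rfl⟩
    | exact ⟨(-1, -1), rfl⟩
    | exact ⟨(-2, 0), rfl⟩
    | exact ⟨(-2, -1), rfl⟩
    | exact ⟨(-3, 0), rfl⟩
    | exact ⟨(-3, -1), rfl⟩
    | exact ⟨(0, -2), rfl⟩

theorem letterPatch_isSubpatch_iterate (a c : Letter) (k : ℕ) :
    (letterPatch a).IsSubpatch (substPatch^[k + 2] (letterPatch c)) := by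
  induction k generalizing c with
  | zero => exact letterPatch_isSubpatch_two a c
  | succ k ih =>
    rw [show k + 1 + 2 = (k + 2) + 1 by ring, Function.iterate_succ_apply]
    refine (ih (rule c 0)).trans (Patch.IsSubpatch.substPatch_iterate ?_ _)
    exact letterPatch_isSubpatch (γ := 0) rfl

theorem letter_iterate_isSubpatch (a c : Letter) (n k : ℕ) :
    (substPatch^[n] (letterPatch a)).IsSubpatch (substPatch^[n + (k + 2)] (letterPatch c)) := by
  rw [Function.iterate_add_apply]
  exact (letterPatch_isSubpatch_iterate a c k).substPatch_iterate n

/-! ### Windows -/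

/-- The positions `{0, 1}²`. -/
def corner : Set (ℤ × ℤ) := {0, 1} ×ˢ {0, 1}

theorem corner_finite : corner.Finite := (Set.toFinite _).prod (Set.toFinite _)

/-- The `2 × 2` block of a patch with lower left corner `γ`, moved to the origin. -/
noncomputable def Patch.window {A : Type} (Q : Patch A) (γ : ℤ × ℤ) : Patch A :=
  (Q.shift γ).restrict corner

theorem Patch.window_isSubpatch {A : Type} (Q : Patch A) (γ : ℤ × ℤ) :
    (Q.window γ).IsSubpatch Q :=
  (Patch.restrict_isSubpatch _ _).trans (Patch.shift_isSubpatch _ _)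

/-- An interval of $2^n+1$ consecutive integers meets at most two consecutive blocks of length
$2^n$. The window starts at the block containing the lower left corner of the occurrence of the box.
-/
theorem exists_window {P Q : Patch Letter} {n : ℕ} (h : P.IsSubpatch (substPatch^[n] Q))
    {z : ℤ × ℤ} (hz : ∀ x ∈ P.support,
      (z.1 ≤ x.1 ∧ x.1 ≤ z.1 + 2 ^ n) ∧ (z.2 ≤ x.2 ∧ x.2 ≤ z.2 + 2 ^ n)) :
    ∃ γ, P.IsSubpatch (substPatch^[n] (Q.window γ)) := by
  obtain ⟨δ, hδ⟩ := h
  refine ⟨parent^[n] (δ + z), δ - 2 ^ n • parent^[n] (δ + z), fun η a ha => ?_⟩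
  have hη := hz η (by simp [Patch.support, ha])
  set γ := parent^[n] (δ + z) with hγ
  have hb := (parent_iterate_eq_iff n _ _).1 hγ.symm
  have hmem : parent^[n] (δ - 2 ^ n • γ + η) ∈ corner := by
    have hx := (parent_iterate_eq_iff n (δ - 2 ^ n • γ + η) _).1 rfl
    set κ := parent^[n] (δ - 2 ^ n • γ + η)
    simp only [Prod.fst_add, Prod.snd_add, Prod.fst_sub, Prod.snd_sub,
      two_pow_smul_fst, two_pow_smul_snd] at hx hb
    have hN : (0 : ℤ) < 2 ^ n := by positivity
    have key : ∀ k : ℤ, 2 ^ n * k - 2 ^ n < 2 ^ n → - 2 ^ n < 2 ^ n * k → k = 0 ∨ k = 1 := by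
      intro k h1 h2
      have h3 : k < 2 := by nlinarith
      have h4 : -1 < k := by nlinarith
      omega
    refine ⟨key _ ?_ ?_, key _ ?_ ?_⟩ <;> omega
  rw [Patch.window, substPatch_iterate_restrict_of_mem n _ hmem, substPatch_iterate_shift]
  have : 2 ^ n • γ + (δ - 2 ^ n • γ + η) = δ + η := by abel
  rw [this]
  exact hδ _ _ ha

/-! ### Legal patches -/

theorem Patch.IsSubpatch.support_finite {A : Type} {P Q : Patch A} (h : P.IsSubpatch Q)
    (hQ : Q.support.Finite) : P.support.Finite := by
  obtain ⟨γ, hγ⟩ := h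
  refine (hQ.preimage (f := fun x => γ + x) (add_right_injective γ).injOn).subset ?_
  intro x hx
  obtain ⟨a, ha⟩ := Option.ne_none_iff_exists'.1 hx
  simp [Patch.support, hγ x a ha]

theorem substPatch_support_finite {P : Patch Letter} (h : P.support.Finite) :
    (substPatch P).support.Finite := by
  refine Set.Finite.subset ((h.prod ((Set.toFinite ({-1, 0} : Set ℤ)).prod
    (Set.toFinite ({-1, 0} : Set ℤ)))).image fun p => 2 • p.1 + p.2) ?_
  intro x hx
  refine ⟨(parent x, position x), ⟨?_, position_mem x⟩, ?_⟩
  · intro h0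
    apply hx
    simp [substPatch, h0]
  · simp [position]

theorem letterPatch_iterate_support_finite (a : Letter) (n : ℕ) :
    (substPatch^[n] (letterPatch a)).support.Finite := by
  induction n with
  | zero =>
    refine (Set.finite_singleton 0).subset fun x hx => ?_
    by_contra h
    exact hx (if_neg h)
  | succ n ih =>
    rw [Function.iterate_succ_apply']
    exact substPatch_support_finite ih

theorem letterPatch_eq_restrict {Q : Patch Letter} {a : Letter} (h : Q 0 = some a) :
    letterPatch a = Q.restrict {0} := by
  funext x
  by_cases hx : x = 0
  · subst hx
    rw [Patch.restrict_of_mem _ (Set.mem_singleton _), h]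
    rfl
  · rw [Patch.restrict_of_notMem _ (by simpa using hx)]
    exact if_neg hx

theorem mem_legalPatches_of_isSubpatch_iterate {P : Patch Letter} {n : ℕ} {a : Letter}
    (h : P.IsSubpatch (substPatch^[n] (letterPatch a))) : P ∈ legalPatches := by
  refine ⟨h.support_finite (letterPatch_iterate_support_finite a n), n + (0 + 2), by omega,
    a, h.trans (letter_iterate_isSubpatch a a n 0)⟩

theorem legalPatches_of_isSubpatch {P Q : Patch Letter} (h : P.IsSubpatch Q)
    (hQ : Q ∈ legalPatches) : P ∈ legalPatches := by
  obtain ⟨-, n, -, a, ha⟩ := hQ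
  exact mem_legalPatches_of_isSubpatch_iterate (h.trans ha)

theorem substPatch_iterate_mem_legalPatches {P : Patch Letter} (h : P ∈ legalPatches) (n : ℕ) :
    substPatch^[n] P ∈ legalPatches := by
  obtain ⟨-, m, -, a, ha⟩ := h
  refine mem_legalPatches_of_isSubpatch_iterate (n := n + m) (a := a) ?_
  rw [Function.iterate_add_apply]
  exact ha.substPatch_iterate n

theorem finite_patches_support_subset {A : Type} [Finite A] {M : Set (ℤ × ℤ)} (hM : M.Finite) :
    {P : Patch A | P.support ⊆ M}.Finite := by
  have : Finite M := hM
  refine Set.Finite.of_finite_image (f := fun (P : Patch A) (x : M) => P x) (Set.toFinite _) ?_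
  intro P hP Q hQ h
  funext x
  by_cases hx : x ∈ M
  · exact congrFun h ⟨x, hx⟩
  · rw [not_not.1 fun h' => hx (hP h'), not_not.1 fun h' => hx (hQ h')]

/-- By primitivity a fixed legal patch occurs in $S^k(c)$ for all $c$ and all large $k$. Only
finitely many patches are supported in `corner`, so a common $k$ exists. -/
theorem exists_order_of_legal_window :
    ∃ k : ℕ, ∀ P ∈ legalPatches, P.support ⊆ corner → ∀ c,
      P.IsSubpatch (substPatch^[k] (letterPatch c)) := by
  have hfin : {P : Patch Letter | P ∈ legalPatches ∧ P.support ⊆ corner}.Finite :=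
    (finite_patches_support_subset corner_finite).subset fun P hP => hP.2
  have hev : ∀ᶠ k in atTop, ∀ P ∈ {P : Patch Letter | P ∈ legalPatches ∧ P.support ⊆ corner},
      ∀ c, P.IsSubpatch (substPatch^[k] (letterPatch c)) := by
    rw [Filter.eventually_all_finite hfin]
    rintro P ⟨⟨-, n, -, a, ha⟩, -⟩
    filter_upwards [eventually_ge_atTop (n + 2)] with k hk c
    obtain ⟨j, rfl⟩ := Nat.exists_eq_add_of_le hk
    have := ha.trans (letter_iterate_isSubpatch a c n j)
    rwa [show n + 2 + j = n + (j + 2) by ring]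
  obtain ⟨k, hk⟩ := hev.exists
  exact ⟨k, fun P hP hs c => hk P ⟨hP, hs⟩ c⟩

theorem isSubpatch_of_legal_of_box {k : ℕ} (hk : ∀ P ∈ legalPatches, P.support ⊆ corner → ∀ c,
      P.IsSubpatch (substPatch^[k] (letterPatch c))) {P : Patch Letter} (hP : P ∈ legalPatches)
    {j : ℕ} {z : ℤ × ℤ} (hz : ∀ x ∈ P.support,
      (z.1 ≤ x.1 ∧ x.1 ≤ z.1 + 2 ^ j) ∧ (z.2 ≤ x.2 ∧ x.2 ≤ z.2 + 2 ^ j)) (c : Letter) :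
    P.IsSubpatch (substPatch^[j + k] (letterPatch c)) := by
  obtain ⟨-, m, -, a, ha⟩ := hP
  -- Nothing bounds the order $m$ of the given occurrence from below by $j$, so it is first raised
  -- to $j+(m+2)$; this exhibits $P$ inside $S^j$ of a legal patch.
  have h := ha.trans (letter_iterate_isSubpatch a a m j)
  rw [show m + (j + 2) = j + (m + 2) by ring, Function.iterate_add_apply] at h
  obtain ⟨γ, hγ⟩ := exists_window h hz
  rw [Function.iterate_add_apply]
  refine hγ.trans (Patch.IsSubpatch.substPatch_iterate (hk _ ?_ ?_ c) j)
  · exact mem_legalPatches_of_isSubpatch_iterate (Patch.window_isSubpatch _ γ)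
  · exact Patch.support_restrict_subset _ _

/-! ### Balls of `ℤ²` -/

theorem mem_ball_zero_iff {x : ℤ × ℤ} {r : ℝ} :
    x ∈ Metric.ball (0 : ℤ × ℤ) r ↔ |(x.1 : ℝ)| < r ∧ |(x.2 : ℝ)| < r := by
  rw [Metric.mem_ball, Prod.dist_eq, max_lt_iff, Int.dist_eq, Int.dist_eq]
  simp

theorem ball_finite (r : ℝ) : (Metric.ball (0 : ℤ × ℤ) r).Finite :=
  (Metric.isCompact_of_isClosed_isBounded Metric.isClosed_closedBall
    Metric.isBounded_closedBall).finite_of_discrete.subset Metric.ball_subset_closedBall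

theorem ball_subset_box {r : ℝ} {j : ℕ} (h : r ≤ 2 ^ j) {x : ℤ × ℤ}
    (hx : x ∈ Metric.ball (0 : ℤ × ℤ) r) :
    (-2 ^ j ≤ x.1 ∧ x.1 ≤ -2 ^ j + 2 ^ (j + 1)) ∧
      (-2 ^ j ≤ x.2 ∧ x.2 ≤ -2 ^ j + 2 ^ (j + 1)) := by
  rw [mem_ball_zero_iff, abs_lt, abs_lt] at hx
  obtain ⟨⟨h1, h2⟩, h3, h4⟩ := hx
  have a1 : (-2 ^ j : ℤ) < x.1 := by
    exact_mod_cast (by push_cast; linarith : ((-2 ^ j : ℤ) : ℝ) < x.1)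
  have a2 : x.1 < (2 ^ j : ℤ) := by
    exact_mod_cast (by push_cast; linarith : (x.1 : ℝ) < (2 ^ j : ℤ))
  have a3 : (-2 ^ j : ℤ) < x.2 := by
    exact_mod_cast (by push_cast; linarith : ((-2 ^ j : ℤ) : ℝ) < x.2)
  have a4 : x.2 < (2 ^ j : ℤ) := by
    exact_mod_cast (by push_cast; linarith : (x.2 : ℝ) < (2 ^ j : ℤ))
  rw [pow_succ]
  omega

theorem mem_ball_of_bounds {r : ℝ} {j : ℕ} (h : 2 ^ j ≤ r) {x : ℤ × ℤ}
    (hx : (-2 ^ j < x.1 ∧ x.1 < 2 ^ j) ∧ (-2 ^ j < x.2 ∧ x.2 < 2 ^ j)) :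
    x ∈ Metric.ball (0 : ℤ × ℤ) r := by
  rw [mem_ball_zero_iff, abs_lt, abs_lt]
  obtain ⟨⟨h1, h2⟩, h3, h4⟩ := hx
  have a1 : ((-2 ^ j : ℤ) : ℝ) < x.1 := by exact_mod_cast h1
  have a2 : (x.1 : ℝ) < (2 ^ j : ℤ) := by exact_mod_cast h2
  have a3 : ((-2 ^ j : ℤ) : ℝ) < x.2 := by exact_mod_cast h3
  have a4 : (x.2 : ℝ) < (2 ^ j : ℤ) := by exact_mod_cast h4
  push_cast at a1 a2 a3 a4
  refine ⟨⟨?_, ?_⟩, ?_, ?_⟩ <;> linarith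

theorem isSubpatch_of_legal_of_ball {k : ℕ} (hk : ∀ P ∈ legalPatches, P.support ⊆ corner → ∀ c,
      P.IsSubpatch (substPatch^[k] (letterPatch c))) {P : Patch Letter} (hP : P ∈ legalPatches)
    {j : ℕ} {r : ℝ} (hr : r ≤ 2 ^ j) (hs : P.support ⊆ Metric.ball 0 r) (c : Letter) :
    P.IsSubpatch (substPatch^[j + 1 + k] (letterPatch c)) :=
  isSubpatch_of_legal_of_box hk hP (z := (-2 ^ j, -2 ^ j))
    (fun _ hx => ball_subset_box hr (hs hx)) c

/-- The level-$n$ block containing the centre of the ball consists of points at distance less than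
$2^n$ from that centre, so the whole block lies in the ball. -/
theorem exists_letter_iterate_isSubpatch {P : Patch Letter} (hP : P ∈ legalPatches) {n : ℕ}
    {R : ℝ} (hR : 2 ^ n ≤ R) (hs : Metric.ball 0 R ⊆ P.support) :
    ∃ b, (substPatch^[n] (letterPatch b)).IsSubpatch P := by
  obtain ⟨-, m, -, a, ha⟩ := hP
  have h := ha.trans (letter_iterate_isSubpatch a a m n)
  rw [show m + (n + 2) = n + (m + 2) by ring, Function.iterate_add_apply] at h
  set Q := substPatch^[m + 2] (letterPatch a)
  obtain ⟨δ, hδ⟩ := h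
  set γ := parent^[n] δ with hγ
  have hb := (parent_iterate_eq_iff n _ _).1 hγ.symm
  have hN : (0 : ℤ) < 2 ^ n := by positivity
  have hval : ∀ x ∈ Metric.ball 0 R, substPatch^[n] Q (δ + x) = P x := by
    intro x hx
    obtain ⟨c, hc⟩ := Option.ne_none_iff_exists'.1 (hs hx)
    rw [hc]
    exact hδ x c hc
  have h0 : (0 : ℤ × ℤ) ∈ Metric.ball 0 R :=
    mem_ball_of_bounds hR ⟨⟨by simp, by simp⟩, by simp, by simp⟩
  have hQ : Q γ ≠ none := by
    rw [hγ, Ne, ← substPatch_iterate_eq_none_iff, ← add_zero δ, hval 0 h0]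
    exact hs h0
  obtain ⟨b, hQb⟩ := Option.ne_none_iff_exists'.1 hQ
  have hrep : letterPatch b = (Q.shift γ).restrict {0} :=
    letterPatch_eq_restrict (by rw [Patch.shift, add_zero, hQb])
  refine ⟨b, 2 ^ n • γ - δ, fun η c hc => ?_⟩
  have hη : parent^[n] η = 0 := by
    by_contra hne
    have h' := (substPatch_iterate_eq_none_iff n (letterPatch b) η).2 (if_neg hne)
    rw [h'] at hc
    cases hc
  rw [hrep, substPatch_iterate_restrict_of_mem n _ (by simp [hη]), substPatch_iterate_shift] at hc
  have hη' := (parent_iterate_eq_iff n _ _).1 hη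
  have hball : 2 ^ n • γ - δ + η ∈ Metric.ball (0 : ℤ × ℤ) R := by
    refine mem_ball_of_bounds hR ?_
    simp only [Prod.fst_add, Prod.snd_add, Prod.fst_sub, Prod.snd_sub, two_pow_smul_fst,
      two_pow_smul_snd, Prod.fst_zero, Prod.snd_zero, mul_zero] at hη' ⊢
    omega
  rw [← hval _ hball, ← hc, show δ + (2 ^ n • γ - δ + η) = 2 ^ n • γ + η by abel]

/-! ### The table tiling subshift -/

theorem Config.restrict_mem_dict {A : Type} (ω : Config A) {M : Set (ℤ × ℤ)} (hM : M.Finite) :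
    ω.toPatch.restrict M ∈ dict ω :=
  ⟨hM.subset (Patch.support_restrict_subset _ _), Patch.restrict_isSubpatch _ _⟩

theorem Config.support_restrict {A : Type} (ω : Config A) (M : Set (ℤ × ℤ)) :
    (ω.toPatch.restrict M).support = M := by
  refine (Patch.support_restrict_subset _ _).antisymm fun x hx => ?_
  rw [Patch.support, Set.mem_ofPred_eq, Patch.restrict_of_mem _ hx]
  exact Option.some_ne_none _

theorem Config.translate_toPatch_isSubpatch {A : Type} (ω : Config A) (γ : ℤ × ℤ) :
    (translate γ ω).toPatch.IsSubpatch ω.toPatch :=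
  ⟨-γ, fun _ _ h => h⟩

theorem mem_tableSubshift_iff {ω : Config Letter} :
    ω ∈ tableSubshift ↔ ∀ n : ℕ, ω.toPatch.restrict (Metric.ball 0 n) ∈ legalPatches := by
  refine ⟨fun h n => h (ω.restrict_mem_dict (ball_finite n)), fun h P hP => ?_⟩
  obtain ⟨hfin, γ, hγ⟩ := hP
  have hfin' : ((fun x => γ + x) '' P.support).Finite := hfin.image _
  obtain ⟨R, hR⟩ := hfin'.isBounded.subset_ball 0
  obtain ⟨n, hn⟩ := exists_nat_ge R
  refine legalPatches_of_isSubpatch ⟨γ, fun η a ha => ?_⟩ (h n)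
  rw [Patch.restrict_of_mem]
  · exact hγ η a ha
  · exact Metric.ball_subset_ball hn (hR ⟨η, by simp [Patch.support, ha], rfl⟩)

theorem Config.agree_of_dist_lt {A : Type} {ω ρ : Config A} {r : ℝ}
    (h : dist ω ρ < 1 / (r + 1)) : Agree ω ρ r := by
  obtain ⟨s, ⟨t, ht, hag, rfl⟩, hs⟩ := exists_lt_of_csInf_lt (agreeSet_nonempty ω ρ) h
  have : r ≤ t := by
    by_contra hlt
    push Not at hlt
    have : 1 / (r + 1) < 1 / (t + 1) := one_div_lt_one_div_of_lt (by linarith) (by linarith)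
    linarith
  exact fun x hx => hag x (Metric.ball_subset_ball this hx)

/-- Membership depends only on the values on $B(0,n)$, which are shared by all configurations at
distance less than $1/(n+1)$. -/
theorem isClosed_setOf_restrict_mem {A : Type} (n : ℕ) (L : Set (Patch A)) :
    IsClosed {ω : Config A | ω.toPatch.restrict (Metric.ball 0 n) ∈ L} := by
  rw [← isOpen_compl_iff, Metric.isOpen_iff]
  intro ω hω
  refine ⟨1 / (n + 1), by positivity, fun ρ hρ hmem => hω ?_⟩
  have hag := Config.agree_of_dist_lt hρ
  have : ω.toPatch.restrict (Metric.ball 0 n) = ρ.toPatch.restrict (Metric.ball 0 n) := by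
    funext x
    by_cases hx : x ∈ Metric.ball (0 : ℤ × ℤ) n
    · rw [Patch.restrict_of_mem _ hx, Patch.restrict_of_mem _ hx]
      exact congrArg some (hag x hx).symm
    · rw [Patch.restrict_of_notMem _ hx, Patch.restrict_of_notMem _ hx]
  rw [Set.mem_ofPred_eq, this]
  exact hmem

theorem tableSubshift_eq_iInter : tableSubshift =
    ⋂ n : ℕ, {ω | ω.toPatch.restrict (Metric.ball 0 n) ∈ legalPatches} := by
  ext ω
  rw [mem_tableSubshift_iff, Set.mem_iInter]
  rfl

theorem isClosed_tableSubshift : IsClosed tableSubshift := by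
  rw [tableSubshift_eq_iInter]
  exact isClosed_iInter fun n => isClosed_setOf_restrict_mem n _

theorem exists_restrict_ball_legal (n : ℕ) :
    ∃ ω : Config Letter, ω.toPatch.restrict (Metric.ball 0 n) ∈ legalPatches := by
  obtain ⟨m, hm⟩ := pow_unbounded_of_one_lt (n : ℝ) one_lt_two
  let ρ : Config Letter := fun _ => .red
  have hmono : letterPatch .red = ρ.toPatch.restrict {0} := letterPatch_eq_restrict rfl
  -- The centre of the block $S^{m+1}(r)$, around which the block contains a ball of radius $2^m>n$.
  let γ : ℤ × ℤ := (-2 ^ m, -2 ^ m)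
  refine ⟨fun x => subst^[m + 1] ρ (γ + x),
    mem_legalPatches_of_isSubpatch_iterate (n := m + 1) (a := .red) ⟨γ, fun η a ha => ?_⟩⟩
  by_cases hη : η ∈ Metric.ball (0 : ℤ × ℤ) n
  · rw [Patch.restrict_of_mem _ hη] at ha
    have hη' := mem_ball_zero_iff.1 hη
    rw [abs_lt, abs_lt] at hη'
    obtain ⟨⟨h1, h2⟩, h3, h4⟩ := hη'
    have a1 : (-2 ^ m : ℤ) < η.1 := by
      exact_mod_cast (by push_cast; linarith : ((-2 ^ m : ℤ) : ℝ) < η.1)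
    have a2 : η.1 < (2 ^ m : ℤ) := by
      exact_mod_cast (by push_cast; linarith : (η.1 : ℝ) < (2 ^ m : ℤ))
    have a3 : (-2 ^ m : ℤ) < η.2 := by
      exact_mod_cast (by push_cast; linarith : ((-2 ^ m : ℤ) : ℝ) < η.2)
    have a4 : η.2 < (2 ^ m : ℤ) := by
      exact_mod_cast (by push_cast; linarith : (η.2 : ℝ) < (2 ^ m : ℤ))
    rw [hmono, substPatch_iterate_restrict_of_mem, substPatch_iterate_toPatch]
    · exact ha
    · rw [Set.mem_singleton_iff, parent_iterate_eq_iff]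
      simp only [γ, Prod.fst_add, Prod.snd_add, Prod.fst_zero, Prod.snd_zero, mul_zero,
        pow_succ]
      omega
  · rw [Patch.restrict_of_notMem _ hη] at ha
    cases ha

theorem isSubshift_tableSubshift : IsSubshift tableSubshift := by
  refine ⟨?_, isClosed_tableSubshift, fun γ ω hω P hP => ?_⟩
  · rw [tableSubshift_eq_iInter]
    -- Compactness: the configurations with a legal patch on $B(0,n)$ form a decreasing sequence of
    -- nonempty closed sets.
    refine IsCompact.nonempty_iInter_of_sequence_nonempty_isCompact_isClosed _ (fun n => ?_)
      exists_restrict_ball_legal (isClosed_setOf_restrict_mem 0 _).isCompact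
      fun n => isClosed_setOf_restrict_mem n _
    intro ω hω
    refine legalPatches_of_isSubpatch ⟨0, fun η a ha => ?_⟩ hω
    by_cases hη : η ∈ Metric.ball (0 : ℤ × ℤ) n
    · rw [Patch.restrict_of_mem _ hη] at ha
      rw [zero_add, Patch.restrict_of_mem _ (Metric.ball_subset_ball (by simp) hη), ha]
    · rw [Patch.restrict_of_notMem _ hη] at ha
      cases ha
  · exact hω ⟨hP.1, hP.2.trans (ω.translate_toPatch_isSubpatch γ)⟩

theorem legal_of_mem_dictOn {M : Set (ℤ × ℤ)} {P : Patch Letter}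
    (h : P ∈ dictOn tableSubshift M) : P ∈ legalPatches := by
  obtain ⟨-, ω, hω, hP⟩ := h
  exact hω hP

/-- Minimality: a large enough ball of $\omega$ contains some $S^n(b)$ with $n$ beyond the order at
which $P$ occurs in the iterates of every letter. -/
theorem isSubpatch_of_legal_of_mem {P : Patch Letter} (hP : P ∈ legalPatches)
    {ω : Config Letter} (hω : ω ∈ tableSubshift) : P.IsSubpatch ω.toPatch := by
  obtain ⟨k, hk⟩ := exists_order_of_legal_window
  obtain ⟨R, hR⟩ := hP.1.isBounded.subset_ball 0
  obtain ⟨j, hj⟩ := pow_unbounded_of_one_lt R one_lt_two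
  have hleg := hω (ω.restrict_mem_dict (ball_finite (2 ^ (j + 1 + k))))
  obtain ⟨b, hb⟩ := exists_letter_iterate_isSubpatch hleg le_rfl
    (ω.support_restrict _).symm.subset
  exact ((isSubpatch_of_legal_of_ball hk hP hj.le hR b).trans hb).trans
    (Patch.restrict_isSubpatch _ _)

theorem mem_dictOn_of_legal {P : Patch Letter} (hP : P ∈ legalPatches) :
    P ∈ dictOn tableSubshift P.support := by
  obtain ⟨ω, hω⟩ := isSubshift_tableSubshift.1
  exact ⟨rfl, ω, hω, hP.1, isSubpatch_of_legal_of_mem hP hω⟩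

theorem repetitivityConstants_nonempty : (repetitivityConstants tableSubshift).Nonempty := by
  obtain ⟨k, hk⟩ := exists_order_of_legal_window
  -- With $2^j\le r<2^{j+1}$, a patch of radius $r$ occurs in every $S^{j+2+k}(b)$, and
  -- $2^{j+2+k}\le 4\cdot 2^k r$.
  refine ⟨4 * 2 ^ k, ?_, fun r R hr hR P hP Q hQ => ?_⟩
  · have : (1 : ℝ) ≤ 2 ^ k := one_le_pow₀ one_le_two
    linarith
  · obtain ⟨j, hj1, hj2⟩ := exists_nat_pow_near hr one_lt_two
    have hle : (2 : ℝ) ^ (j + 1 + 1 + k) ≤ R := by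
      refine le_trans ?_ hR
      calc (2 : ℝ) ^ (j + 1 + 1 + k) = 4 * 2 ^ k * 2 ^ j := by ring
        _ ≤ 4 * 2 ^ k * r := by gcongr
    obtain ⟨b, hb⟩ := exists_letter_iterate_isSubpatch (legal_of_mem_dictOn hP) hle
      hP.1.symm.subset
    exact (isSubpatch_of_legal_of_ball hk (legal_of_mem_dictOn hQ) hj2.le hQ.1.subset b).trans hb

/-! ### The linear repetitivity constant is attained -/

theorem mem_ball_zero_iff_lt_ceil {x : ℤ × ℤ} {r : ℝ} :
    x ∈ Metric.ball (0 : ℤ × ℤ) r ↔ |x.1| < ⌈r⌉ ∧ |x.2| < ⌈r⌉ := by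
  rw [mem_ball_zero_iff, Int.lt_ceil, Int.lt_ceil]
  push_cast
  rfl

theorem ball_eq_of_ceil_eq {r s : ℝ} (h : ⌈r⌉ = ⌈s⌉) :
    Metric.ball (0 : ℤ × ℤ) r = Metric.ball 0 s := by
  ext x
  rw [mem_ball_zero_iff_lt_ceil, mem_ball_zero_iff_lt_ceil, h]

theorem restrict_shift_mem_dictOn {A : Type} {Ω : Set (Config A)} {ω : Config A} (hω : ω ∈ Ω)
    {M : Set (ℤ × ℤ)} (hM : M.Finite) (γ : ℤ × ℤ) :
    (ω.toPatch.shift γ).restrict M ∈ dictOn Ω M := by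
  have hs : ((ω.toPatch.shift γ).restrict M).support = M :=
    (Patch.support_restrict_subset _ _).antisymm fun x hx => by
      rw [Patch.support, Set.mem_ofPred_eq, Patch.restrict_of_mem _ hx]
      exact Option.some_ne_none _
  exact ⟨hs, ω, hω, by rwa [hs],
    (Patch.restrict_isSubpatch _ _).trans (Patch.shift_isSubpatch _ _)⟩

theorem exists_extension {A : Type} {Ω : Set (Config A)} {M N : Set (ℤ × ℤ)} {P : Patch A}
    (hP : P ∈ dictOn Ω M) (hN : N.Finite) (hMN : M ⊆ N) :
    ∃ P' ∈ dictOn Ω N, ∀ x ∈ M, P' x = P x := by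
  obtain ⟨hs, ω, hω, -, γ, hγ⟩ := hP
  refine ⟨(ω.toPatch.shift γ).restrict N, restrict_shift_mem_dictOn hω hN γ, fun x hx => ?_⟩
  have hx' : x ∈ P.support := hs ▸ hx
  obtain ⟨a, ha⟩ := Option.ne_none_iff_exists'.1 hx'
  rw [Patch.restrict_of_mem _ (hMN hx), ha, ← hγ x a ha]
  rfl

/-- Open balls of $\mathbb Z^2$ depend only on $\lceil r\rceil$. For $r>1$ the radius can be lowered
a little without changing the ball, which leaves room for an admissible constant slightly above the
infimum. At $r=1$ lowering is forbidden by $r\ge1$, so both patches are enlarged instead. -/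
theorem isLeast_linRepConst {A : Type} {Ω : Set (Config A)}
    (hne : (repetitivityConstants Ω).Nonempty) :
    IsLeast (repetitivityConstants Ω) (linRepConst Ω) := by
  have hbdd : BddBelow (repetitivityConstants Ω) := ⟨1, fun C hC => hC.1⟩
  refine ⟨⟨le_csInf hne fun C hC => hC.1, fun r R hr hR P hP Q hQ => ?_⟩,
    fun C hC => csInf_le hbdd hC⟩
  have hC1 : 1 ≤ linRepConst Ω := le_csInf hne fun C hC => hC.1
  rcases hr.eq_or_lt with rfl | hr1
  · rw [mul_one] at hR
    obtain ⟨C, hC, hCR⟩ := exists_lt_of_csInf_lt hne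
      (show sInf (repetitivityConstants Ω) < R + 1 from hR.trans_lt (lt_add_one R))
    have hC0 : 0 < C := zero_lt_one.trans_le hC.1
    -- Both patches gain one layer. The ball of radius 2 equals the ball of radius
    -- $s=\min(2,(R+1)/C)>1$, and $Cs\le R+1$, so the admissible constant $C$ applies.
    obtain ⟨P', hP', hPP'⟩ := exists_extension hP (ball_finite (R + 1))
      (Metric.ball_subset_ball (by linarith))
    obtain ⟨Q', hQ', hQQ'⟩ := exists_extension hQ (ball_finite 2)
      (Metric.ball_subset_ball (by norm_num))
    have hs1 : 1 < min 2 ((R + 1) / C) :=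
      lt_min one_lt_two ((one_lt_div hC0).2 hCR)
    have hceil : ⌈min 2 ((R + 1) / C)⌉ = ⌈(2 : ℝ)⌉ := by
      rw [show ⌈(2 : ℝ)⌉ = 2 from Int.ceil_ofNat 2, Int.ceil_eq_iff]
      exact ⟨by push_cast; linarith, by push_cast; exact min_le_left _ _⟩
    rw [← ball_eq_of_ceil_eq hceil] at hQ'
    obtain ⟨γ, hγ⟩ := hC.2 _ (R + 1) hs1.le
      (by rw [mul_comm, ← le_div_iff₀ hC0]; exact min_le_right _ _) P' hP' Q' hQ'
    have hQs : ∀ x ∈ Metric.ball (0 : ℤ × ℤ) 2, γ + x ∈ Metric.ball (0 : ℤ × ℤ) (R + 1) := by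
      intro x hx
      rw [← ball_eq_of_ceil_eq hceil, ← hQ'.1] at hx
      obtain ⟨a, ha⟩ := Option.ne_none_iff_exists'.1 hx
      rw [← hP'.1, Patch.support, Set.mem_ofPred_eq, hγ x a ha]
      exact Option.some_ne_none a
    have h11 := hQs (1, 1) (by rw [mem_ball_zero_iff]; norm_num)
    have h22 := hQs (-1, -1) (by rw [mem_ball_zero_iff]; norm_num)
    -- The enlarged $3\times3$ patch fits into $B(0,R+1)$, so its centre stays in $B(0,R)$, where
    -- the extension agrees with $P$.
    have hγR : γ ∈ Metric.ball (0 : ℤ × ℤ) R := by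
      rw [mem_ball_zero_iff, abs_lt, abs_lt] at h11 h22 ⊢
      simp only [Prod.fst_add, Prod.snd_add] at h11 h22
      push_cast at h11 h22
      refine ⟨⟨?_, ?_⟩, ?_, ?_⟩ <;> linarith
    refine ⟨γ, fun η a ha => ?_⟩
    have hη : η ∈ Metric.ball (0 : ℤ × ℤ) 1 := by
      rw [← hQ.1, Patch.support, Set.mem_ofPred_eq, ha]
      exact Option.some_ne_none a
    obtain rfl : η = 0 := by
      rw [mem_ball_zero_iff_lt_ceil, Int.ceil_one, Int.abs_lt_one_iff, Int.abs_lt_one_iff] at hη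
      exact Prod.ext hη.1 hη.2
    rw [add_zero, ← hPP' γ hγR]
    simpa using hγ 0 a (by rw [hQQ' 0 hη, ha])
  -- The midpoint of $\lceil r\rceil-1$ and $r$: it is below $r$, has the same ceiling and is at
  -- least 1.
  · set s : ℝ := ((⌈r⌉ - 1 : ℤ) + r) / 2 with hs
    have hc1 : ((⌈r⌉ - 1 : ℤ) : ℝ) < r := by
      have := Int.ceil_lt_add_one r
      push_cast
      linarith
    have hc2 : (1 : ℝ) ≤ (⌈r⌉ - 1 : ℤ) := by
      have : 1 < ⌈r⌉ := Int.lt_ceil.2 (by simpa using hr1)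
      exact_mod_cast (by omega : 1 ≤ ⌈r⌉ - 1)
    have hsr : s < r := by rw [hs]; linarith
    have hs1 : 1 ≤ s := by rw [hs]; linarith
    have hceil : ⌈s⌉ = ⌈r⌉ := by
      rw [Int.ceil_eq_iff]
      refine ⟨?_, hsr.le.trans (Int.le_ceil r)⟩
      have : (⌈r⌉ : ℝ) - 1 = (⌈r⌉ - 1 : ℤ) := by push_cast; ring
      rw [this, hs]
      linarith
    have hs0 : 0 < s := by linarith
    obtain ⟨C, hC, hCR⟩ := exists_lt_of_csInf_lt hne
      (show sInf (repetitivityConstants Ω) < R / s by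
        rw [lt_div_iff₀ hs0]
        refine lt_of_lt_of_le ?_ hR
        exact mul_lt_mul_of_pos_left hsr (by linarith : 0 < linRepConst Ω))
    rw [← ball_eq_of_ceil_eq hceil] at hQ
    exact hC.2 s R hs1 ((lt_div_iff₀ hs0).1 hCR).le P hP Q hQ

/-! ### The two checkerboards -/

theorem checkerboard_apply (a b : Letter) (x : ℤ × ℤ) :
    checkerboard a b x = if Even (x.1 + x.2) then a else b := by
  unfold checkerboard
  congr 1
  rw [Int.even_add, ← Int.not_even_iff_odd, ← Int.not_even_iff_odd]
  exact propext (by tauto)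

theorem checkerboard_add (a b : Letter) (γ x : ℤ × ℤ) : checkerboard a b (γ + x) =
    if Even (γ.1 + γ.2) then checkerboard a b x else checkerboard b a x := by
  have h : Even ((γ + x).1 + (γ + x).2) ↔ (Even (γ.1 + γ.2) ↔ Even (x.1 + x.2)) := by
    rw [← Int.even_add, Prod.fst_add, Prod.snd_add, add_add_add_comm]
  simp only [checkerboard_apply, h]
  by_cases h1 : Even (γ.1 + γ.2) <;> by_cases h2 : Even (x.1 + x.2) <;> simp [h1, h2]

theorem checkerboard_translate (a b : Letter) (γ : ℤ × ℤ) :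
    Config.translate γ (checkerboard a b) =
      if Even (γ.1 + γ.2) then checkerboard a b else checkerboard b a := by
  funext x
  rw [Config.translate, checkerboard_add]
  simp only [Prod.fst_neg, Prod.snd_neg, ← neg_add, even_neg]
  split_ifs <;> rfl

theorem checkerboard_orbit (a b : Letter) :
    (checkerboard a b).orbit = {checkerboard a b, checkerboard b a} := by
  ext ω
  constructor
  · rintro ⟨γ, rfl⟩
    change Config.translate γ _ ∈ _
    rw [checkerboard_translate]
    split_ifs <;> simp
  · rintro (rfl | rfl)
    · exact ⟨0, by change Config.translate 0 _ = _; rw [checkerboard_translate]; simp⟩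
    · exact ⟨(1, 0), by change Config.translate (1, 0) _ = _; rw [checkerboard_translate]; simp⟩

theorem checkerboard_orbit_ncard {a b : Letter} (h : a ≠ b) :
    (checkerboard a b).orbit.ncard = 2 := by
  rw [checkerboard_orbit, Set.ncard_pair]
  exact fun h' => h (congrFun h' 0)

theorem Config.isPeriodic_of_forall {A : Type} {ω : Config A} {N : ℕ} (hN : 0 < N)
    (h : ∀ γ x, ω (N • γ + x) = ω x) : ω.IsPeriodic := by
  refine (((Set.finite_Ico (0 : ℤ) N).prod (Set.finite_Ico (0 : ℤ) N)).image
    fun γ => translate γ ω).subset ?_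
  rintro _ ⟨γ, rfl⟩
  have hN' : (0 : ℤ) < N := by exact_mod_cast hN
  refine ⟨(γ.1 % N, γ.2 % N), ⟨⟨Int.emod_nonneg _ hN'.ne', Int.emod_lt_of_pos _ hN'⟩,
    Int.emod_nonneg _ hN'.ne', Int.emod_lt_of_pos _ hN'⟩, ?_⟩
  funext x
  change ω _ = ω _
  rw [← h (γ.1 / N, γ.2 / N) (-γ + x)]
  congr 1
  ext
  · simp only [Prod.fst_add, Prod.fst_neg, Prod.smul_fst]
    rw [nsmul_eq_mul]
    have := Int.emod_add_mul_ediv γ.1 N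
    linarith
  · simp only [Prod.snd_add, Prod.snd_neg, Prod.smul_snd]
    rw [nsmul_eq_mul]
    have := Int.emod_add_mul_ediv γ.2 N
    linarith

theorem checkerboard_subst_isPeriodic (a b : Letter) (n : ℕ) :
    (subst^[n] (checkerboard a b)).IsPeriodic := by
  refine Config.isPeriodic_of_forall (N := 2 ^ n * 2) (by positivity) fun γ x => ?_
  have h := substPatch_iterate_shift n (checkerboard a b).toPatch (2 • γ) x
  have hshift : (checkerboard a b).toPatch.shift (2 • γ) = (checkerboard a b).toPatch := by
    funext y
    have : Even ((2 • γ).1 + (2 • γ).2) := by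
      rw [two_smul]
      exact ⟨γ.1 + γ.2, by simp only [Prod.fst_add, Prod.snd_add]; ring⟩
    change some _ = some _
    rw [checkerboard_add, if_pos this]
  rw [hshift, substPatch_iterate_toPatch, ← mul_smul] at h
  exact (Option.some_injective _ h).symm

/-- The hypothesis reads off the central $2\times2$ square of $S^2(c)$, where the four blocks of
level 1 meet. -/
theorem checkerboard_window_legal_aux {a b c : Letter}
    (h : (substPatch^[2] (letterPatch c) (-2, -2) = some a ∧
        substPatch^[2] (letterPatch c) (-1, -2) = some b) ∧
      (substPatch^[2] (letterPatch c) (-2, -1) = some b ∧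
        substPatch^[2] (letterPatch c) (-1, -1) = some a)) :
    (checkerboard a b).toPatch.window 0 ∈ legalPatches := by
  refine mem_legalPatches_of_isSubpatch_iterate (n := 2) (a := c) ⟨(-2, -2), fun η d hd => ?_⟩
  by_cases hη : η ∈ corner
  · rw [Patch.window, Patch.restrict_of_mem _ hη, Patch.shift, zero_add, Config.toPatch] at hd
    obtain ⟨x, y⟩ := η
    obtain ⟨hx | hx, hy | hy⟩ := hη <;> obtain rfl : x = _ := hx <;> obtain rfl : y = _ := hy <;>
      rw [← hd, checkerboard_apply]
    exacts [h.1.1, h.2.1, h.1.2, h.2.2]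
  · rw [Patch.window, Patch.restrict_of_notMem _ hη] at hd
    cases hd

theorem checkerboard_window_legal {ω₀ : Config Letter} (h : ω₀ ∈ ({omegaRB, omegaGY} : Set _))
    (γ : ℤ × ℤ) : ω₀.toPatch.window γ ∈ legalPatches := by
  have key : ∀ a b : Letter, (checkerboard a b).toPatch.window 0 ∈ legalPatches →
      (checkerboard b a).toPatch.window 0 ∈ legalPatches →
      (checkerboard a b).toPatch.window γ ∈ legalPatches := by
    intro a b hab hba
    have hw : (checkerboard a b).toPatch.shift γ =
        (if Even (γ.1 + γ.2) then checkerboard a b else checkerboard b a).toPatch.shift 0 := by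
      funext x
      change some _ = some _
      rw [checkerboard_add, zero_add]
      split_ifs <;> rfl
    rw [Patch.window, hw]
    split_ifs
    exacts [hab, hba]
  rcases h with rfl | rfl
  · exact key _ _ (checkerboard_window_legal_aux (c := .yellow) ⟨⟨rfl, rfl⟩, rfl, rfl⟩)
      (checkerboard_window_legal_aux (c := .gray) ⟨⟨rfl, rfl⟩, rfl, rfl⟩)
  · exact key _ _ (checkerboard_window_legal_aux (c := .blue) ⟨⟨rfl, rfl⟩, rfl, rfl⟩)
      (checkerboard_window_legal_aux (c := .red) ⟨⟨rfl, rfl⟩, rfl, rfl⟩)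

/-! ### Comparison of local patterns -/

/-- Every pattern of `ω` on a ball of radius `r` occurs in `ρ`. -/
def LocallyIn {A : Type} (r : ℝ) (ω ρ : Config A) : Prop :=
  ∀ γ, ∃ τ, ∀ x ∈ Metric.ball (0 : ℤ × ℤ) r, ω (γ + x) = ρ (τ + x)

theorem locallyIn_iff {A : Type} {r : ℝ} {ω ρ : Config A} : LocallyIn r ω ρ ↔
    ∀ γ, ((ω.toPatch.shift γ).restrict (Metric.ball 0 r)).IsSubpatch ρ.toPatch := by
  refine forall_congr' fun γ => exists_congr fun τ => ⟨fun h η a ha => ?_, fun h x hx => ?_⟩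
  · by_cases hη : η ∈ Metric.ball (0 : ℤ × ℤ) r
    · rw [Patch.restrict_of_mem _ hη] at ha
      rw [← ha]
      exact congrArg some (h η hη).symm
    · rw [Patch.restrict_of_notMem _ hη] at ha
      cases ha
  · exact (Option.some_injective _ (h x (ω (γ + x)) (Patch.restrict_of_mem _ hx))).symm

/-- A ball of radius $r\le 2^{n-1}$ in $S^n(\omega_0)$ is covered by the image of one $2\times2$
window of $\omega_0$. That window is legal, so the patch is legal and minimality applies. -/
theorem locallyIn_tableSubshift {ω₀ : Config Letter} (h₀ : ∀ γ, ω₀.toPatch.window γ ∈ legalPatches)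
    {n : ℕ} {r : ℝ} (hr : 2 * r ≤ 2 ^ n) {ω : Config Letter} (hω : ω ∈ tableSubshift) :
    LocallyIn r (subst^[n] ω₀) ω := by
  rw [locallyIn_iff]
  intro γ
  refine isSubpatch_of_legal_of_mem ?_ hω
  rcases n with _ | n
  -- Without a substitution step the ball contains no point other than the origin, and one window
  -- covers it.
  · have hr' : r ≤ 1 / 2 := by norm_num at hr; linarith
    refine legalPatches_of_isSubpatch (Q := ω₀.toPatch.window γ) ⟨0, fun η a ha => ?_⟩ (h₀ γ)
    by_cases hη : η ∈ Metric.ball (0 : ℤ × ℤ) r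
    · have hη1 := Metric.ball_subset_ball (show r ≤ 1 by linarith) hη
      rw [mem_ball_zero_iff_lt_ceil, Int.ceil_one, Int.abs_lt_one_iff, Int.abs_lt_one_iff] at hη1
      rw [Patch.restrict_of_mem _ hη] at ha
      rw [zero_add, Patch.window, Patch.restrict_of_mem]
      · exact ha
      · exact ⟨Or.inl hη1.1, Or.inl hη1.2⟩
    · rw [Patch.restrict_of_notMem _ hη] at ha
      cases ha
  · have hr' : r ≤ 2 ^ n := by rw [pow_succ] at hr; linarith
    have hsub : ((subst^[n + 1] ω₀).toPatch.shift γ).restrict (Metric.ball 0 r) |>.IsSubpatch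
        (substPatch^[n + 1] ω₀.toPatch) := by
      rw [substPatch_iterate_toPatch]
      exact (Patch.restrict_isSubpatch _ _).trans (Patch.shift_isSubpatch _ _)
    obtain ⟨δ, hδ⟩ := exists_window hsub (z := (-2 ^ n, -2 ^ n)) fun x hx =>
      ball_subset_box hr' (Patch.support_restrict_subset _ _ hx)
    exact legalPatches_of_isSubpatch hδ (substPatch_iterate_mem_legalPatches (h₀ δ) _)

/-- The image of a single letter of $\omega_0$ already contains a ball of radius $2^{n-1}\ge Cr$
carrying a legal patch, to which repetitivity applies. -/
theorem locallyIn_subst {ω₀ : Config Letter} {n : ℕ} {r C : ℝ}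
    (hC : C ∈ repetitivityConstants tableSubshift) (hr1 : 1 ≤ r) (hr : 2 * C * r ≤ 2 ^ n)
    {ω : Config Letter} (hω : ω ∈ tableSubshift) : LocallyIn r ω (subst^[n] ω₀) := by
  rw [locallyIn_iff]
  intro γ
  have hleg : ∀ n : ℕ, substPatch^[n] (letterPatch (ω₀ 0)) ∈ legalPatches := fun n =>
    mem_legalPatches_of_isSubpatch_iterate (Patch.IsSubpatch.refl _)
  have hmem := restrict_shift_mem_dictOn hω (ball_finite r) γ
  rcases n with _ | n
  -- Impossible case: $2Cr\ge2>2^0$.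
  · nlinarith [hC.1]
  set T := substPatch^[n + 1] (letterPatch (ω₀ 0)) with hT
  have hTω : T.IsSubpatch (subst^[n + 1] ω₀).toPatch := by
    rw [← substPatch_iterate_toPatch]
    exact (letterPatch_isSubpatch (γ := 0) rfl).substPatch_iterate _
  set z : ℤ × ℤ := (-2 ^ n, -2 ^ n) with hz
  have hsupp : ((T.shift z).restrict (Metric.ball 0 (2 ^ n))).support = Metric.ball 0 (2 ^ n) := by
    refine (Patch.support_restrict_subset _ _).antisymm fun x hx => ?_
    rw [Patch.support, Set.mem_ofPred_eq, Patch.restrict_of_mem _ hx, Patch.shift, hT, Ne,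
      substPatch_iterate_eq_none_iff]
    have hpar : parent^[n + 1] (z + x) = 0 := by
      rw [parent_iterate_eq_iff]
      have hx' := mem_ball_zero_iff_lt_ceil.1 hx
      have hceil : ⌈(2 : ℝ) ^ n⌉ = 2 ^ n := by
        rw [show (2 : ℝ) ^ n = ((2 ^ n : ℤ) : ℝ) by push_cast; rfl, Int.ceil_intCast]
      rw [hceil, abs_lt, abs_lt] at hx'
      simp only [hz, Prod.fst_add, Prod.snd_add, Prod.fst_zero, Prod.snd_zero, mul_zero, pow_succ]
      omega
    rw [hpar]
    exact Option.some_ne_none (ω₀ 0)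
  have hsubT : ((T.shift z).restrict (Metric.ball 0 (2 ^ n))).IsSubpatch T :=
    (Patch.restrict_isSubpatch _ _).trans (Patch.shift_isSubpatch _ _)
  have hP := mem_dictOn_of_legal (legalPatches_of_isSubpatch hsubT (hleg _))
  rw [hsupp] at hP
  refine ((hC.2 r (2 ^ n) hr1 ?_ _ hP _ hmem).trans hsubT).trans hTω
  rw [pow_succ] at hr
  linarith

/-- The default value 0 of `Metric.hausdorffDist` plays no role: both sets are nonempty and all
distances are at most 1. -/
theorem hausdorffDist_orbit_le {A : Type} {Ω : Set (Config A)} (hΩ : IsSubshift Ω) {ρ : Config A}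
    {r : ℝ} (hr : 0 ≤ r) (h₁ : ∀ ω ∈ Ω, LocallyIn r ω ρ) (h₂ : ∀ ω ∈ Ω, LocallyIn r ρ ω) :
    Metric.hausdorffDist ρ.orbit Ω ≤ 1 / (r + 1) := by
  refine Metric.hausdorffDist_le_of_mem_dist (by positivity) ?_ ?_
  · rintro _ ⟨γ, rfl⟩
    obtain ⟨ω, hω⟩ := hΩ.1
    obtain ⟨τ, hτ⟩ := h₂ ω hω (-γ)
    refine ⟨Config.translate (-τ) ω, hΩ.2.2 _ ω hω, Config.dist_le_of_agree hr fun x hx => ?_⟩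
    simpa only [Config.translate, neg_neg] using hτ x hx
  · intro ω hω
    obtain ⟨τ, hτ⟩ := h₁ ω hω 0
    refine ⟨_, ⟨-τ, rfl⟩, Config.dist_le_of_agree hr fun x hx => ?_⟩
    simpa only [Config.translate, neg_neg, zero_add] using hτ x hx

/-! ### Self-adjoint operators -/

/-- The resolvent comes from the continuous functional calculus applied to $x\mapsto(z-x)^{-1}$,
whose supremum on the spectrum is at most $1/d$. -/
theorem exists_left_inverse_norm_le {A : Type*} [CStarAlgebra A] {a : A} (ha : IsStarNormal a)
    {z : ℂ} {d : ℝ} (hd : 0 < d) (hle : ∀ x ∈ spectrum ℂ a, d ≤ ‖z - x‖) :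
    ∃ b : A, ‖b‖ ≤ d⁻¹ ∧ b * (algebraMap ℂ A z - a) = 1 := by
  have hne : ∀ x ∈ spectrum ℂ a, z - x ≠ 0 := fun x hx =>
    norm_pos_iff.1 (hd.trans_le (hle x hx))
  have hcont : ContinuousOn (fun x : ℂ => (z - x)⁻¹) (spectrum ℂ a) :=
    ContinuousOn.inv₀ (by fun_prop) hne
  have hcont' : ContinuousOn (fun x : ℂ => z - x) (spectrum ℂ a) := by fun_prop
  refine ⟨cfc (fun x : ℂ => (z - x)⁻¹) a, norm_cfc_le (by positivity) fun x hx => ?_, ?_⟩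
  · rw [norm_inv]
    exact inv_anti₀ hd (hle x hx)
  · have hsub : cfc (fun x : ℂ => z - x) a = algebraMap ℂ A z - a := by
      rw [cfc_sub (fun _ => z) (fun x => x) a continuousOn_const continuousOn_id,
        cfc_const z a ha, cfc_id' ℂ a ha]
    rw [← hsub, ← cfc_mul _ _ a hcont hcont', ← cfc_const_one ℂ a ha]
    exact cfc_congr fun x hx => inv_mul_cancel₀ (hne x hx)

section SelfAdjoint

variable {E : Type*} [NormedAddCommGroup E] [InnerProductSpace ℂ E] [CompleteSpace E]

/-- Bounded below means injective with closed range. Self-adjointness identifies the orthogonal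
complement of the range with the kernel, so the range is everything. -/
theorem isUnit_of_isSelfAdjoint_of_bound {T : E →L[ℂ] E} (hT : IsSelfAdjoint T) {ε : ℝ}
    (hε : 0 < ε) (h : ∀ ψ, ε * ‖ψ‖ ≤ ‖T ψ‖) : IsUnit T := by
  have hanti : AntilipschitzWith (Real.toNNReal ε⁻¹) T := by
    refine ContinuousLinearMap.antilipschitz_of_bound T fun ψ => ?_
    rw [Real.coe_toNNReal _ (by positivity), ← div_eq_inv_mul, le_div_iff₀' hε]
    exact h ψ
  rw [ContinuousLinearMap.isUnit_iff_bijective]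
  refine ⟨hanti.injective, ?_⟩
  have hclosed : IsClosed (Set.range T) := hanti.isClosed_range T.uniformContinuous
  have hker : T.rangeᗮ = ⊥ := by
    rw [ContinuousLinearMap.orthogonal_range, hT.adjoint_eq]
    exact LinearMap.ker_eq_bot.2 hanti.injective
  have : CompleteSpace T.range := hclosed.completeSpace_coe
  have htop := Submodule.orthogonal_eq_bot_iff.1 hker
  exact LinearMap.range_eq_top.1 htop

theorem exists_approximate_eigenvector {T : E →L[ℂ] E} (hT : IsSelfAdjoint T) {z : ℂ}
    (hz : z ∈ spectrum ℂ T) {ε : ℝ} (hε : 0 < ε) :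
    ∃ ψ : E, ψ ≠ 0 ∧ ‖T ψ - z • ψ‖ ≤ ε * ‖ψ‖ := by
  by_contra! hcon
  -- Spectral points are real, so $z-T$ is again self-adjoint.
  have hre : z = z.re := hT.mem_spectrum_eq_re hz
  have hsa : IsSelfAdjoint (algebraMap ℂ (E →L[ℂ] E) z - T) := by
    refine IsSelfAdjoint.sub ?_ hT
    rw [hre]
    refine IsSelfAdjoint.algebraMap _ ?_
    exact Complex.conj_ofReal _
  refine hz (isUnit_of_isSelfAdjoint_of_bound hsa hε fun ψ => ?_)
  rcases eq_or_ne ψ 0 with rfl | hψ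
  · simp
  · have : (algebraMap ℂ (E →L[ℂ] E) z - T) ψ = -(T ψ - z • ψ) := by
      rw [sub_apply, ContinuousLinearMap.algebraMap_apply, neg_sub]
    rw [this, norm_neg]
    exact (hcon ψ hψ).le

/-- If the nearest spectral point were farther than $\delta$, the resolvent would have norm less
than $1/\delta$ (for $\delta>0$), contradicting the residual bound for $\varphi$. -/
theorem exists_mem_spectrum_dist_le [Nontrivial E] {T : E →L[ℂ] E} (hT : IsSelfAdjoint T) {z : ℂ}
    {φ : E} (hφ : φ ≠ 0) {δ : ℝ} (h : ‖T φ - z • φ‖ ≤ δ * ‖φ‖) :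
    ∃ w ∈ spectrum ℂ T, dist z w ≤ δ := by
  have hnorm := hT.isStarNormal
  obtain ⟨w, hw, hmin⟩ := (spectrum.isCompact (𝕜 := ℂ) T).exists_infDist_eq_dist
    (spectrum.nonempty T) z
  refine ⟨w, hw, ?_⟩
  by_contra! hlt
  have hφ0 : 0 < ‖φ‖ := norm_pos_iff.2 hφ
  have hδ : 0 ≤ δ := nonneg_of_mul_nonneg_left ((norm_nonneg _).trans h) hφ0
  have hd : 0 < dist z w := hδ.trans_lt hlt
  have hle : ∀ x ∈ spectrum ℂ T, dist z w ≤ ‖z - x‖ := fun x hx => by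
    rw [← hmin, ← dist_eq_norm]
    exact Metric.infDist_le_dist_of_mem hx
  obtain ⟨S, hS, hinv⟩ := exists_left_inverse_norm_le hnorm hd hle
  have hval : S (-(T φ - z • φ)) = φ := by
    rw [neg_sub]
    exact congrArg (fun S : E →L[ℂ] E => S φ) hinv
  have : ‖φ‖ ≤ (dist z w)⁻¹ * (δ * ‖φ‖) := by
    calc ‖φ‖ = ‖S (-(T φ - z • φ))‖ := by rw [hval]
      _ ≤ ‖S‖ * ‖-(T φ - z • φ)‖ :=
        ContinuousLinearMap.le_opNorm _ _
      _ ≤ _ := by rw [norm_neg]; gcongr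
  rw [← div_eq_inv_mul, le_div_iff₀ hd] at this
  nlinarith

end SelfAdjoint

/-! ### Localization of approximate eigenvectors -/

theorem ofReal_norm_sq (ψ : L2) :
    ENNReal.ofReal (‖ψ‖ ^ 2) = ∑' γ, ENNReal.ofReal (‖ψ γ‖ ^ 2) := by
  have h2 : (0 : ℝ) < (2 : ENNReal).toReal := by norm_num
  have hs : HasSum (fun γ => ‖ψ γ‖ ^ 2) (‖ψ‖ ^ 2) := by
    simpa using lp.hasSum_norm h2 ψ
  rw [← hs.tsum_eq, ENNReal.ofReal_tsum_of_nonneg (fun γ => by positivity) hs.summable]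

/-- Tonelli and translation invariance; working in `ENNReal` avoids all summability conditions in
the averaging argument. -/
theorem tsum_tsum_sub_mul (a b : ℤ × ℤ → ENNReal) :
    ∑' x, ∑' γ, a (γ - x) * b γ = (∑' u, a u) * ∑' γ, b γ := by
  rw [ENNReal.tsum_comm, ← ENNReal.tsum_mul_left]
  refine tsum_congr fun γ => ?_
  rw [ENNReal.tsum_mul_right]
  congr 1
  exact (Equiv.subLeft γ).tsum_eq a

theorem exists_mul_vector (f : ℤ × ℤ → ℝ) (hf : ∃ M : ℝ, ∀ u, |f u| ≤ M) (x : ℤ × ℤ) (ψ : L2) :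
    ∃ φ : L2, ∀ γ, φ γ = f (γ - x) * ψ γ := by
  refine ⟨weightedShift (fun γ => (f (γ - x) : ℂ)) ?_ 0 ψ, fun γ => ?_⟩
  · obtain ⟨M, hM⟩ := hf
    exact ⟨M, fun γ => by simpa using hM (γ - x)⟩
  · change (f (γ - x) : ℂ) * ψ (γ + 0) = _
    rw [add_zero]

theorem norm_sq_cutoff_le {T : L2 →L[ℂ] L2} {B : Finset (ℤ × ℤ)} {c : ℤ × ℤ → ℤ × ℤ → ℂ}
    (hT : ∀ ψ γ, T ψ γ = ∑ η ∈ B, c η γ * ψ (γ + η)) {M : ℝ}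
    (hM : ∀ η ∈ B, ∀ γ, ‖c η γ‖ ≤ M) (f : ℤ × ℤ → ℝ) (z : ℂ) {ψ φ : L2} {x : ℤ × ℤ}
    (hφ : ∀ γ, φ γ = f (γ - x) * ψ γ) (γ : ℤ × ℤ) :
    ‖(T φ - z • φ) γ‖ ^ 2 ≤ f (γ - x) ^ 2 * (2 * ‖(T ψ - z • ψ) γ‖ ^ 2) +
      ∑ η ∈ B, (2 * B.card * M ^ 2 * (f (γ - x + η) - f (γ - x)) ^ 2) * ‖ψ (γ + η)‖ ^ 2 := by
  have hsub : ∀ χ : L2, (T χ - z • χ) γ = (∑ η ∈ B, c η γ * χ (γ + η)) - z * χ γ := fun χ => by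
    rw [← hT χ γ]
    rfl
  -- Commutator identity: the error of the cutoff vector is the cutoff error plus terms that see
  -- only the increments of $f$.
  have hsplit : (T φ - z • φ) γ = f (γ - x) * (T ψ - z • ψ) γ +
      ∑ η ∈ B, c η γ * ((f (γ - x + η) - f (γ - x) : ℝ) * ψ (γ + η)) := by
    rw [hsub, hsub, mul_sub, Finset.mul_sum, sub_add_eq_add_sub, ← Finset.sum_add_distrib]
    congr 1
    · refine Finset.sum_congr rfl fun η _ => ?_
      rw [hφ, add_sub_right_comm]
      push_cast
      ring
    · rw [hφ]
      ring
  have h1 : ‖∑ η ∈ B, c η γ * ((f (γ - x + η) - f (γ - x) : ℝ) * ψ (γ + η))‖ ^ 2 ≤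
      B.card * ∑ η ∈ B, M ^ 2 * (f (γ - x + η) - f (γ - x)) ^ 2 * ‖ψ (γ + η)‖ ^ 2 := by
    refine (pow_le_pow_left₀ (norm_nonneg _) (norm_sum_le _ _) 2).trans ?_
    refine (sq_sum_le_card_mul_sum_sq).trans ?_
    gcongr with η hη
    rw [norm_mul, norm_mul, mul_pow, mul_pow, Complex.norm_real, Real.norm_eq_abs, sq_abs,
      ← mul_assoc]
    gcongr
    exact hM η hη γ
  rw [hsplit]
  refine (pow_le_pow_left₀ (norm_nonneg _) (norm_add_le _ _) 2).trans ?_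
  refine add_sq_le.trans ?_
  rw [norm_mul, mul_pow, Complex.norm_real, Real.norm_eq_abs, sq_abs]
  have h2 : ∑ η ∈ B, (2 * B.card * M ^ 2 * (f (γ - x + η) - f (γ - x)) ^ 2) * ‖ψ (γ + η)‖ ^ 2 =
      2 * (B.card * ∑ η ∈ B, M ^ 2 * (f (γ - x + η) - f (γ - x)) ^ 2 * ‖ψ (γ + η)‖ ^ 2) := by
    rw [Finset.mul_sum, Finset.mul_sum]
    exact Finset.sum_congr rfl fun η _ => by ring
  rw [h2]
  linarith

theorem tsum_norm_sq_cutoff_le {T : L2 →L[ℂ] L2} {B : Finset (ℤ × ℤ)} {c : ℤ × ℤ → ℤ × ℤ → ℂ}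
    (hT : ∀ ψ γ, T ψ γ = ∑ η ∈ B, c η γ * ψ (γ + η)) {M : ℝ}
    (hM : ∀ η ∈ B, ∀ γ, ‖c η γ‖ ≤ M) (f : ℤ × ℤ → ℝ) (z : ℂ) {ψ : L2} {φ : ℤ × ℤ → L2}
    (hφ : ∀ x γ, φ x γ = f (γ - x) * ψ γ) :
    ∑' x, ENNReal.ofReal (‖T (φ x) - z • φ x‖ ^ 2) ≤
      (∑' u, ENNReal.ofReal (f u ^ 2)) * ENNReal.ofReal (2 * ‖T ψ - z • ψ‖ ^ 2) +
      ∑ η ∈ B, (∑' u, ENNReal.ofReal (2 * B.card * M ^ 2 * (f (u + η) - f u) ^ 2)) *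
        ENNReal.ofReal (‖ψ‖ ^ 2) := by
  have hpt : ∀ x γ, ENNReal.ofReal (‖(T (φ x) - z • φ x) γ‖ ^ 2) ≤
      ENNReal.ofReal (f (γ - x) ^ 2) * ENNReal.ofReal (2 * ‖(T ψ - z • ψ) γ‖ ^ 2) +
      ∑ η ∈ B, ENNReal.ofReal (2 * B.card * M ^ 2 * (f (γ - x + η) - f (γ - x)) ^ 2) *
        ENNReal.ofReal (‖ψ (γ + η)‖ ^ 2) := by
    intro x γ
    refine (ENNReal.ofReal_le_ofReal (norm_sq_cutoff_le hT hM f z (hφ x) γ)).trans ?_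
    rw [ENNReal.ofReal_add (by positivity) (Finset.sum_nonneg fun η _ => by positivity),
      ENNReal.ofReal_mul (by positivity), ENNReal.ofReal_sum_of_nonneg fun η _ => by positivity]
    gcongr with η
    rw [ENNReal.ofReal_mul (by positivity)]
  calc ∑' x, ENNReal.ofReal (‖T (φ x) - z • φ x‖ ^ 2)
      = ∑' x, ∑' γ, ENNReal.ofReal (‖(T (φ x) - z • φ x) γ‖ ^ 2) :=
        tsum_congr fun x => ofReal_norm_sq _
    _ ≤ ∑' x, ∑' γ, (ENNReal.ofReal (f (γ - x) ^ 2) * ENNReal.ofReal (2 * ‖(T ψ - z • ψ) γ‖ ^ 2) +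
      ∑ η ∈ B, ENNReal.ofReal (2 * B.card * M ^ 2 * (f (γ - x + η) - f (γ - x)) ^ 2) *
        ENNReal.ofReal (‖ψ (γ + η)‖ ^ 2)) :=
        ENNReal.tsum_le_tsum fun x => ENNReal.tsum_le_tsum fun γ => hpt x γ
    _ = _ := by
      simp only [ENNReal.tsum_add, Summable.tsum_finsetSum fun _ _ => ENNReal.summable]
      congr 1
      · rw [tsum_tsum_sub_mul (fun u => ENNReal.ofReal (f u ^ 2))
          (fun γ => ENNReal.ofReal (2 * ‖(T ψ - z • ψ) γ‖ ^ 2))]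
        congr 1
        simp only [ENNReal.ofReal_mul zero_le_two, ENNReal.tsum_mul_left, ofReal_norm_sq]
      · refine Finset.sum_congr rfl fun η _ => ?_
        rw [tsum_tsum_sub_mul
          (fun u => ENNReal.ofReal (2 * B.card * M ^ 2 * (f (u + η) - f u) ^ 2))
          (fun γ => ENNReal.ofReal (‖ψ (γ + η)‖ ^ 2)), ofReal_norm_sq]
        congr 1
        exact (Equiv.addRight η).tsum_eq fun γ => ENNReal.ofReal (‖ψ γ‖ ^ 2)

/-- The tent function of radius `2 s`. -/
noncomputable def tent (s : ℕ) (u : ℤ × ℤ) : ℝ := max 0 (1 - ‖u‖ / (2 * s))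

theorem tent_nonneg (s : ℕ) (u : ℤ × ℤ) : 0 ≤ tent s u := le_max_left _ _

theorem tent_le_one (s : ℕ) (u : ℤ × ℤ) : tent s u ≤ 1 :=
  max_le zero_le_one (sub_le_self _ (by positivity))

theorem tent_eq_zero {s : ℕ} (hs : 0 < s) {u : ℤ × ℤ} (hu : 2 * s ≤ ‖u‖) : tent s u = 0 := by
  have hs' : (0 : ℝ) < s := by exact_mod_cast hs
  refine max_eq_left (sub_nonpos.2 ?_)
  rwa [one_le_div (by positivity)]

theorem half_le_tent {s : ℕ} (hs : 0 < s) {u : ℤ × ℤ} (hu : ‖u‖ ≤ s) : 1 / 2 ≤ tent s u := by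
  have hs' : (0 : ℝ) < s := by exact_mod_cast hs
  refine le_max_of_le_right ?_
  have : ‖u‖ / (2 * s) ≤ 1 / 2 := by
    rw [div_le_iff₀ (by positivity)]
    linarith
  linarith

theorem abs_tent_sub_le (s : ℕ) (u η : ℤ × ℤ) :
    |tent s (u + η) - tent s u| ≤ ‖η‖ / (2 * s) := by
  refine (abs_max_sub_max_le_max _ _ _ _).trans (max_le (by simp; positivity) ?_)
  rw [sub_sub_sub_cancel_left, ← sub_div, abs_div, abs_of_nonneg (show (0 : ℝ) ≤ 2 * s by positivity)]
  gcongr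
  refine (abs_norm_sub_norm_le _ _).trans ?_
  rw [sub_add_cancel_left, norm_neg]

/-- The square `{-m, …, m}²`. -/
noncomputable def square (m : ℕ) : Finset (ℤ × ℤ) := Finset.Icc (-m : ℤ) m ×ˢ Finset.Icc (-m : ℤ) m

theorem mem_square_iff {m : ℕ} {u : ℤ × ℤ} : u ∈ square m ↔ ‖u‖ ≤ m := by
  rw [square, Finset.mem_product, Finset.mem_Icc, Finset.mem_Icc, ← abs_le, ← abs_le,
    Prod.norm_def, max_le_iff, Int.norm_eq_abs, Int.norm_eq_abs]
  norm_cast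

theorem card_square (m : ℕ) : ((square m).card : ℝ) = (2 * m + 1) ^ 2 := by
  have : (square m).card = (2 * m + 1) ^ 2 := by
    rw [square, Finset.card_product, Int.card_Icc, sq]
    congr 1 <;> omega
  rw [this]
  push_cast
  rfl

theorem tsum_ofReal_eq_sum {g : ℤ × ℤ → ℝ} (hg : ∀ u, 0 ≤ g u) {S : Finset (ℤ × ℤ)}
    (hS : ∀ u ∉ S, g u = 0) : ∑' u, ENNReal.ofReal (g u) = ENNReal.ofReal (∑ u ∈ S, g u) := by
  rw [ENNReal.ofReal_sum_of_nonneg fun u _ => hg u]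
  exact tsum_eq_sum fun u hu => by rw [hS u hu, ENNReal.ofReal_zero]

theorem sq_le_sum_tent_sq {s : ℕ} (hs : 0 < s) :
    (s : ℝ) ^ 2 ≤ ∑ u ∈ square (2 * s), tent s u ^ 2 := by
  have hsub : square s ⊆ square (2 * s) := fun u hu => by
    rw [mem_square_iff] at hu ⊢
    push_cast
    linarith [norm_nonneg u]
  calc (s : ℝ) ^ 2 ≤ (square s).card • ((1 / 2 : ℝ) ^ 2) := by
        -- The inner square has $(2s+1)^2$ points, each contributing at least $1/4$.
        rw [nsmul_eq_mul, card_square]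
        nlinarith [Nat.cast_nonneg (α := ℝ) s]
    _ ≤ ∑ u ∈ square s, tent s u ^ 2 := Finset.card_nsmul_le_sum _ _ _ fun u hu => by
        gcongr
        exact half_le_tent hs (mem_square_iff.1 hu)
    _ ≤ _ := Finset.sum_le_sum_of_subset_of_nonneg hsub fun u _ _ => sq_nonneg _

/-- The increments are at most $\rho/(2s)$ on at most $(6s+1)^2\le52s^2$ points, and $52/4=13$. In
dimension two this sum stays bounded, while the sum of the squared tent grows like $s^2$. -/
theorem sum_tent_sub_sq_le {s : ℕ} (hs : 0 < s) {η : ℤ × ℤ} {ρ : ℝ} (hη : ‖η‖ ≤ ρ) :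
    ∑ u ∈ square (3 * s), (tent s (u + η) - tent s u) ^ 2 ≤ 13 * ρ ^ 2 := by
  have hs' : (1 : ℝ) ≤ s := by exact_mod_cast hs
  have hρ : 0 ≤ ρ := (norm_nonneg η).trans hη
  calc ∑ u ∈ square (3 * s), (tent s (u + η) - tent s u) ^ 2
      ≤ (square (3 * s)).card • (ρ / (2 * s)) ^ 2 := Finset.sum_le_card_nsmul _ _ _ fun u _ => by
        rw [← sq_abs]
        gcongr
        exact (abs_tent_sub_le s u η).trans (by gcongr)
    _ ≤ 13 * ρ ^ 2 := by
        rw [nsmul_eq_mul, card_square, div_pow, mul_div_assoc', div_le_iff₀ (by positivity)]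
        push_cast
        have : (2 * (3 * (s : ℝ)) + 1) ^ 2 ≤ 52 * s ^ 2 := by nlinarith
        nlinarith [sq_nonneg ρ]

theorem tent_sub_eq_zero {s : ℕ} (hs : 0 < s) {η : ℤ × ℤ} (hη : ‖η‖ ≤ s) {u : ℤ × ℤ}
    (hu : u ∉ square (3 * s)) : tent s (u + η) - tent s u = 0 := by
  rw [mem_square_iff, not_le] at hu
  push_cast at hu
  have h1 : ‖u‖ ≤ ‖u + η‖ + ‖η‖ := by simpa using norm_sub_le (u + η) η
  have h0 : (0 : ℝ) ≤ s := Nat.cast_nonneg s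
  rw [tent_eq_zero hs (by linarith), tent_eq_zero hs (by linarith), sub_zero]

theorem tsum_tent_sq {s : ℕ} (hs : 0 < s) : ∑' u, ENNReal.ofReal (tent s u ^ 2) =
    ENNReal.ofReal (∑ u ∈ square (2 * s), tent s u ^ 2) :=
  tsum_ofReal_eq_sum (fun u => sq_nonneg _) fun u hu => by
    rw [mem_square_iff, not_le] at hu
    push_cast at hu
    rw [tent_eq_zero hs hu.le]
    simp

theorem tsum_tent_sub_sq_le {s : ℕ} (hs : 0 < s) {η : ℤ × ℤ} {ρ : ℝ} (hη : ‖η‖ ≤ ρ)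
    (hρs : ρ ≤ s) {a : ℝ} (ha : 0 ≤ a) :
    ∑' u, ENNReal.ofReal (a * (tent s (u + η) - tent s u) ^ 2) ≤
      ENNReal.ofReal (a * (13 * ρ ^ 2)) := by
  rw [tsum_ofReal_eq_sum (S := square (3 * s)) (fun u => by positivity) fun u hu => by
    rw [tent_sub_eq_zero hs (hη.trans hρs) hu]; simp, ← Finset.mul_sum]
  refine ENNReal.ofReal_le_ofReal ?_
  gcongr
  exact sum_tent_sub_sq_le hs hη

theorem tsum_norm_sq_mul_eq {f : ℤ × ℤ → ℝ} {ψ : L2} {φ : ℤ × ℤ → L2}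
    (hφ : ∀ x γ, φ x γ = f (γ - x) * ψ γ) :
    ∑' x, ENNReal.ofReal (‖φ x‖ ^ 2) =
      (∑' u, ENNReal.ofReal (f u ^ 2)) * ENNReal.ofReal (‖ψ‖ ^ 2) := by
  rw [ofReal_norm_sq ψ, ← tsum_tsum_sub_mul (fun u => ENNReal.ofReal (f u ^ 2))]
  refine tsum_congr fun x => ?_
  rw [ofReal_norm_sq]
  refine tsum_congr fun γ => ?_
  rw [hφ, norm_mul, mul_pow, Complex.norm_real, Real.norm_eq_abs, sq_abs,
    ENNReal.ofReal_mul (sq_nonneg _)]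

/-- If every translate of the tent gave an error of at least $\delta$, summing the squares over all
translates would yield this inequality, which `exists_localized` refutes. -/
theorem tent_energy_le {T : L2 →L[ℂ] L2} {B : Finset (ℤ × ℤ)} {c : ℤ × ℤ → ℤ × ℤ → ℂ}
    (hT : ∀ ψ γ, T ψ γ = ∑ η ∈ B, c η γ * ψ (γ + η)) {M : ℝ}
    (hM : ∀ η ∈ B, ∀ γ, ‖c η γ‖ ≤ M) {ρ : ℝ} (hρ : ∀ η ∈ B, ‖η‖ ≤ ρ) {s : ℕ}
    (hs : 0 < s) (hρs : ρ ≤ s) {z : ℂ} {ψ : L2} {φ : ℤ × ℤ → L2}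
    (hφ : ∀ x γ, φ x γ = tent s (γ - x) * ψ γ) {δ : ℝ} (hδ : 0 ≤ δ)
    (hcon : ∀ x, δ * ‖φ x‖ ≤ ‖T (φ x) - z • φ x‖) :
    δ ^ 2 * ((∑ u ∈ square (2 * s), tent s u ^ 2) * ‖ψ‖ ^ 2) ≤
      (∑ u ∈ square (2 * s), tent s u ^ 2) * (2 * ‖T ψ - z • ψ‖ ^ 2) +
        B.card * (2 * B.card * M ^ 2 * (13 * ρ ^ 2) * ‖ψ‖ ^ 2) := by
  have hFt := tsum_tent_sq hs
  have hF0 : 0 ≤ ∑ u ∈ square (2 * s), tent s u ^ 2 := Finset.sum_nonneg fun u _ => sq_nonneg _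
  generalize ∑ u ∈ square (2 * s), tent s u ^ 2 = F at hFt hF0 ⊢
  have hlow : ENNReal.ofReal (δ ^ 2 * (F * ‖ψ‖ ^ 2)) ≤
      ∑' x, ENNReal.ofReal (‖T (φ x) - z • φ x‖ ^ 2) := by
    rw [ENNReal.ofReal_mul (by positivity), ENNReal.ofReal_mul hF0, ← hFt,
      ← tsum_norm_sq_mul_eq hφ, ← ENNReal.tsum_mul_left]
    refine ENNReal.tsum_le_tsum fun x => ?_
    rw [← ENNReal.ofReal_mul (by positivity), ← mul_pow]
    exact ENNReal.ofReal_le_ofReal (pow_le_pow_left₀ (by positivity) (hcon x) 2)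
  have hup := hlow.trans (tsum_norm_sq_cutoff_le hT hM (tent s) z hφ)
  rw [hFt] at hup
  refine (ENNReal.ofReal_le_ofReal_iff (by positivity)).1 (hup.trans ?_)
  rw [ENNReal.ofReal_add (by positivity) (by positivity), ENNReal.ofReal_mul hF0]
  refine add_le_add_right ?_ _
  have hsum := Finset.sum_le_card_nsmul B _ (ENNReal.ofReal (2 * B.card * M ^ 2 * (13 * ρ ^ 2)) *
    ENNReal.ofReal (‖ψ‖ ^ 2)) fun η hη => mul_le_mul_left
      (tsum_tent_sub_sq_le hs (hρ η hη) hρs (by positivity : 0 ≤ 2 * B.card * M ^ 2)) _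
  refine hsum.trans (le_of_eq ?_)
  rw [nsmul_eq_mul, ENNReal.ofReal_mul (Nat.cast_nonneg _), ENNReal.ofReal_natCast,
    ENNReal.ofReal_mul (p := 2 * B.card * M ^ 2 * (13 * ρ ^ 2)) (by positivity)]

theorem exists_localized {T : L2 →L[ℂ] L2} {B : Finset (ℤ × ℤ)} {c : ℤ × ℤ → ℤ × ℤ → ℂ}
    (hT : ∀ ψ γ, T ψ γ = ∑ η ∈ B, c η γ * ψ (γ + η)) {M : ℝ} (hM0 : 0 ≤ M)
    (hM : ∀ η ∈ B, ∀ γ, ‖c η γ‖ ≤ M) {ρ : ℝ} (hρ0 : 0 ≤ ρ) (hρ : ∀ η ∈ B, ‖η‖ ≤ ρ) {s : ℕ}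
    (hs : 0 < s) (hρs : ρ ≤ s) {z : ℂ} {ψ : L2} (hψ : ψ ≠ 0) {δ : ℝ}
    (hδ : δ = 8 * (B.card * M * ρ + 1) / s) (hle : ‖T ψ - z • ψ‖ ≤ δ / 2 * ‖ψ‖) :
    ∃ x, ∃ φ : L2, φ ≠ 0 ∧ (∀ γ, 2 * s ≤ ‖γ - x‖ → φ γ = 0) ∧ ‖T φ - z • φ‖ ≤ δ * ‖φ‖ := by
  have hs' : (0 : ℝ) < s := by exact_mod_cast hs
  have hδ0 : 0 < δ := by rw [hδ]; positivity
  choose φ hφ using fun x => exists_mul_vector (tent s)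
    ⟨1, fun u => by rw [abs_of_nonneg (tent_nonneg s u)]; exact tent_le_one s u⟩ x ψ
  by_contra! hcon
  have hcon' : ∀ x, δ * ‖φ x‖ ≤ ‖T (φ x) - z • φ x‖ := by
    intro x
    rcases eq_or_ne (φ x) 0 with h0 | h0
    · simp [h0]
    · exact (hcon x (φ x) h0 fun γ hγ => by rw [hφ, tent_eq_zero hs hγ]; simp).le
  have hreal := tent_energy_le hT hM hρ hs hρs hφ hδ0.le hcon'
  have hFs := sq_le_sum_tent_sq hs
  generalize ∑ u ∈ square (2 * s), tent s u ^ 2 = F at hreal hFs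
  have hF0 : 0 ≤ F := (sq_nonneg _).trans hFs
  have hψ0 : 0 < ‖ψ‖ ^ 2 := by have := norm_pos_iff.2 hψ; positivity
  have hres : ‖T ψ - z • ψ‖ ^ 2 ≤ δ ^ 2 / 4 * ‖ψ‖ ^ 2 := by
    refine (pow_le_pow_left₀ (norm_nonneg _) hle 2).trans (le_of_eq ?_)
    ring
  have h1 : δ ^ 2 * F ≤ F * (δ ^ 2 / 2) + 26 * (B.card * M * ρ) ^ 2 := by
    refine le_of_mul_le_mul_right ?_ hψ0
    calc δ ^ 2 * F * ‖ψ‖ ^ 2 = δ ^ 2 * (F * ‖ψ‖ ^ 2) := by ring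
      _ ≤ _ := hreal
      _ ≤ F * (2 * (δ ^ 2 / 4 * ‖ψ‖ ^ 2)) +
          B.card * (2 * B.card * M ^ 2 * (13 * ρ ^ 2) * ‖ψ‖ ^ 2) := by gcongr
      _ = _ := by ring
  have h2 : δ ^ 2 * s ^ 2 ≤ 52 * (B.card * M * ρ) ^ 2 := by
    have : δ ^ 2 * s ^ 2 ≤ δ ^ 2 * F := by gcongr
    linarith
  have h3 : δ * s = 8 * (B.card * M * ρ + 1) := by
    rw [hδ, div_mul_cancel₀ _ hs'.ne']
  rw [← mul_pow, h3] at h2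
  have : 0 ≤ B.card * M * ρ := by positivity
  -- With $q=|B|M\rho$ the previous steps give $64(q+1)^2\le52q^2$, which is false for $q\ge0$.
  nlinarith

/-! ### Spectral estimate -/

instance : Nontrivial L2 := by
  refine ⟨⟨lp.single 2 0 1, 0, fun h => ?_⟩⟩
  have := congrArg (fun ψ : L2 => ψ 0) h
  simp [lp.single_apply] at this

theorem norm_eq_of_apply_add {φ ψ : L2} {κ : ℤ × ℤ} (h : ∀ γ, φ γ = ψ (γ + κ)) :
    ‖φ‖ = ‖ψ‖ := by
  have : ENNReal.ofReal (‖φ‖ ^ 2) = ENNReal.ofReal (‖ψ‖ ^ 2) := by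
    rw [ofReal_norm_sq, ofReal_norm_sq]
    simp only [h]
    exact (Equiv.addRight κ).tsum_eq fun γ => ENNReal.ofReal (‖ψ γ‖ ^ 2)
  rw [ENNReal.ofReal_eq_ofReal_iff (by positivity) (by positivity)] at this
  exact (pow_left_inj₀ (norm_nonneg _) (norm_nonneg _) two_ne_zero).1 this

theorem norm_weightedShift_le {c : ℤ × ℤ → ℂ} {M : ℝ} (hM : ∀ γ, ‖c γ‖ ≤ M) (η : ℤ × ℤ) :
    ‖weightedShift c ⟨M, hM⟩ η‖ ≤ M := by
  have h0 : 0 ≤ M := (norm_nonneg _).trans (hM 0)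
  refine ContinuousLinearMap.opNorm_le_bound _ h0 fun ψ => ?_
  refine lp.norm_le_of_tsum_le (by norm_num) (by positivity) ?_
  rw [ENNReal.toReal_ofNat]
  exact (memlp_weighted c M hM η ψ).2

/-- Finitely many values are separated by some $\varepsilon$. Uniform continuity on the compact
configuration space makes close configurations have equal values. -/
theorem exists_eq_of_agree {A : Type} [Finite A] {f : Config A → ℂ} (hf : Continuous f)
    (hfin : (Set.range f).Finite) :
    ∃ n : ℕ, ∀ ω ρ, Config.Agree ω ρ n → f ω = f ρ := by
  have hsep : ∀ᶠ ε in 𝓝[>] (0 : ℝ), ∀ a ∈ Set.range f, ∀ b ∈ Set.range f, a ≠ b → ε < dist a b := by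
    rw [Filter.eventually_all_finite hfin]
    intro a _
    rw [Filter.eventually_all_finite hfin]
    intro b _
    by_cases hab : a = b
    · exact Filter.Eventually.of_forall fun ε h => absurd hab h
    · filter_upwards [Ioo_mem_nhdsGT (dist_pos.2 hab)] with ε hε _ using hε.2
  obtain ⟨ε, hε, hε0⟩ := (hsep.and self_mem_nhdsWithin).exists
  obtain ⟨δ, hδ, hunif⟩ := Metric.uniformContinuous_iff.1
    (CompactSpace.uniformContinuous_of_continuous hf) ε hε0
  obtain ⟨n, hn⟩ := exists_nat_one_div_lt hδ
  refine ⟨n, fun ω ρ h => ?_⟩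
  by_contra hne
  have h1 := hunif ((Config.dist_le_of_agree (Nat.cast_nonneg n) h).trans_lt hn)
  exact (hε _ ⟨ω, rfl⟩ _ ⟨ρ, rfl⟩ hne).not_gt h1

namespace FiniteRangeOperator

theorem exists_range_bound {A : Type} (H : FiniteRangeOperator A) : ∃ k : ℕ, ∀ η ∈ H.B, ‖η‖ ≤ k := by
  have : ∀ᶠ k : ℕ in atTop, ∀ η ∈ H.B, ‖η‖ ≤ k := by
    rw [Filter.eventually_all_finset]
    intro η _
    exact tendsto_natCast_atTop_atTop.eventually_ge_atTop _
  exact this.exists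

variable {A : Type} [Finite A] (H : FiniteRangeOperator A)

theorem exists_coefficient_bound : ∃ M : ℝ, 0 ≤ M ∧ ∀ η ∈ H.B, ∀ ω, ‖H.t η ω‖ ≤ M := by
  have : ∀ᶠ M : ℝ in atTop, ∀ η ∈ H.B, ∀ ω, ‖H.t η ω‖ ≤ M := by
    rw [Filter.eventually_all_finset]
    intro η hη
    obtain ⟨M, hM⟩ := isCompact_univ.exists_bound_of_continuousOn (H.continuous_t η hη).continuousOn
    filter_upwards [eventually_ge_atTop M] with M' hM' ω using (hM ω (Set.mem_univ _)).trans hM'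
  obtain ⟨M, hM, h0⟩ := (this.and (eventually_ge_atTop 0)).exists
  exact ⟨M, h0, hM⟩

theorem IsStronglyPatternEquivariant.exists_locality {H : FiniteRangeOperator A}
    (hH : H.IsStronglyPatternEquivariant) :
    ∃ n : ℕ, ∀ η ∈ H.B, ∀ ω ρ, Config.Agree ω ρ n → H.t η ω = H.t η ρ := by
  have : ∀ᶠ n : ℕ in atTop, ∀ η ∈ H.B, ∀ ω ρ, Config.Agree ω ρ n → H.t η ω = H.t η ρ := by
    rw [Filter.eventually_all_finset]
    intro η hη
    obtain ⟨n, hn⟩ := exists_eq_of_agree (H.continuous_t η hη) (hH η hη)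
    filter_upwards [eventually_ge_atTop n] with m hm ω ρ h
    exact hn ω ρ fun x hx => h x (Metric.ball_subset_ball (by exact_mod_cast hm) hx)
  exact this.exists

theorem norm_op_le {M : ℝ} (hM : ∀ η ∈ H.B, ∀ ω, ‖H.t η ω‖ ≤ M) (ω : Config A) :
    ‖H.op ω‖ ≤ H.B.card * M := by
  refine (norm_sum_le _ _).trans ?_
  rw [← Finset.card_attach, ← nsmul_eq_mul]
  exact Finset.sum_le_card_nsmul _ _ _ fun η _ =>
    norm_weightedShift_le (fun γ => hM η.1 η.2 _) η.1

/-- Applying $H_\omega$ to a vector supported within distance $a$ of $x$ involves only sites within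
$a+k$, and the coefficients there read the configuration within $a+k+L$. Inside that radius $\omega$
near $x$ and $\rho$ near $\tau$ coincide. -/
theorem exists_transported {L k : ℕ}
    (hL : ∀ η ∈ H.B, ∀ ω ρ, Config.Agree ω ρ L → H.t η ω = H.t η ρ)
    (hk : ∀ η ∈ H.B, ‖η‖ ≤ k) {r a : ℝ} (hr : a + k + L ≤ r) {ω ρ : Config A} {x τ : ℤ × ℤ}
    (h : ∀ u ∈ Metric.ball (0 : ℤ × ℤ) r, ω (x + u) = ρ (τ + u)) {φ : L2}
    (hφ : ∀ γ, a ≤ ‖γ - x‖ → φ γ = 0) (z : ℂ) :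
    ∃ φ' : L2, ‖φ'‖ = ‖φ‖ ∧ ‖H.op ρ φ' - z • φ'‖ = ‖H.op ω φ - z • φ‖ := by
  set φ' : L2 := weightedShift (fun _ => 1) ⟨1, fun _ => by simp⟩ (x - τ) φ
  have hφ' : ∀ γ, φ' γ = φ (γ + (x - τ)) := fun γ => one_mul _
  refine ⟨φ', norm_eq_of_apply_add hφ', norm_eq_of_apply_add (κ := x - τ) fun γ => ?_⟩
  have hsub : ∀ (σ : Config A) (χ : L2) (β : ℤ × ℤ), (H.op σ χ - z • χ) β =
      (∑ η ∈ H.B, H.t η (Config.translate (-β) σ) * χ (β + η)) - z * χ β := fun σ χ β => by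
    rw [← H.op_apply]
    rfl
  rw [hsub, hsub, hφ']
  congr 1
  refine Finset.sum_congr rfl fun η hη => ?_
  rw [hφ', add_right_comm γ η]
  by_cases hfar : a ≤ ‖γ + (x - τ) + η - x‖
  · rw [hφ _ hfar, mul_zero, mul_zero]
  · congr 1
    refine hL η hη _ _ fun v hv => ?_
    have hball : γ - τ + v ∈ Metric.ball (0 : ℤ × ℤ) r := by
      rw [_root_.mem_ball_zero_iff] at hv ⊢
      have h1 : γ - τ + v = (γ + (x - τ) + η - x) - η + v := by abel
      have h2 := norm_add_le (γ + (x - τ) + η - x - η) v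
      have h3 := norm_sub_le (γ + (x - τ) + η - x) η
      have h4 := hk η hη
      rw [h1]
      linarith
    simp only [Config.translate, neg_neg]
    rw [show γ + v = τ + (γ - τ + v) by abel,
      show γ + (x - τ) + v = x + (γ - τ + v) by abel, h _ hball]

theorem exists_spectrum_dist_le {H : FiniteRangeOperator A} (hH : H.IsStronglyPatternEquivariant) :
    ∃ C : ℝ, 0 < C ∧ ∀ r : ℝ, 1 ≤ r → ∀ ω ρ : Config A, LocallyIn r ω ρ →
      ∀ z ∈ spectrum ℂ (H.op ω), ∃ w ∈ spectrum ℂ (H.op ρ), dist z w ≤ C / r := by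
  obtain ⟨k, hk⟩ := H.exists_range_bound
  obtain ⟨L, hL⟩ := hH.exists_locality
  obtain ⟨M, hM0, hM⟩ := H.exists_coefficient_bound
  -- The scale $6N$ separates two regimes. Below it the crude bound by the operator norms suffices,
  -- and it supplies the second summand of the constant.
  set N : ℝ := k + L + 1 with hN
  have hk0 : (0 : ℝ) ≤ k := Nat.cast_nonneg k
  have hL0 : (0 : ℝ) ≤ L := Nat.cast_nonneg L
  have hB0 : (0 : ℝ) ≤ H.B.card := Nat.cast_nonneg _
  refine ⟨48 * (H.B.card * M * k + 1) + 2 * (H.B.card * M) * (6 * N), by positivity, ?_⟩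
  intro r hr ω ρ hloc z hz
  have hr0 : 0 < r := by linarith
  rcases lt_or_ge r (6 * N) with hsmall | hlarge
  · obtain ⟨w, hw⟩ := spectrum.nonempty (H.op ρ)
    refine ⟨w, hw, (dist_le_norm_add_norm z w).trans ?_⟩
    have h1 := (spectrum.norm_le_norm_of_mem hz).trans (H.norm_op_le hM ω)
    have h2 := (spectrum.norm_le_norm_of_mem hw).trans (H.norm_op_le hM ρ)
    rw [le_div_iff₀ hr0]
    have h3 : (‖z‖ + ‖w‖) * r ≤ 2 * (H.B.card * M) * (6 * N) :=
      mul_le_mul (by linarith) hsmall.le hr0.le (by positivity)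
    have : 0 ≤ H.B.card * M * k := by positivity
    linarith
  -- The tent has radius $2s\le 2r/3$, leaving $r/3\ge k+L$ for range and locality. Since also $s\ge
  -- r/6$, the error $8(\cdot)/s$ becomes $48(\cdot)/r$.
  · set s : ℕ := ⌊r / 3⌋₊ with hs
    have hs1 : (s : ℝ) ≤ r / 3 := Nat.floor_le (by positivity)
    have hs2 : r / 3 < s + 1 := Nat.lt_floor_add_one _
    have hs3 : r / 6 ≤ s := by linarith
    have hs0 : 0 < s := by
      have : (0 : ℝ) < s := by linarith
      exact_mod_cast this
    set δ : ℝ := 8 * (H.B.card * M * k + 1) / s with hδ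
    have hδ0 : 0 < δ := by
      have : (0 : ℝ) < s := by exact_mod_cast hs0
      positivity
    obtain ⟨ψ, hψ, hψle⟩ := exists_approximate_eigenvector (H.op_isSelfAdjoint ω) hz
      (half_pos hδ0)
    obtain ⟨x, φ, hφ, hsupp, hφle⟩ := exists_localized (fun ψ γ => H.op_apply ω ψ γ) hM0
      (fun η hη γ => hM η hη _) hk0 hk hs0 (by linarith : (k : ℝ) ≤ s) hψ hδ hψle
    obtain ⟨τ, hτ⟩ := hloc x
    obtain ⟨φ', hn, hn'⟩ := H.exists_transported hL hk (by linarith : 2 * (s : ℝ) + k + L ≤ r)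
      hτ hsupp z
    obtain ⟨w, hw, hdist⟩ := exists_mem_spectrum_dist_le (H.op_isSelfAdjoint ρ)
      (φ := φ') (norm_ne_zero_iff.1 (by rw [hn]; exact norm_ne_zero_iff.2 hφ))
      (hn'.trans_le (hφle.trans_eq (by rw [hn])))
    refine ⟨w, hw, hdist.trans ?_⟩
    have h4 : δ ≤ 8 * (H.B.card * M * k + 1) / (r / 6) := by
      rw [hδ]
      gcongr
    refine h4.trans ?_
    rw [div_div_eq_mul_div]
    gcongr
    have : 0 ≤ 2 * (H.B.card * M) * (6 * N) := by positivity
    linarith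

end FiniteRangeOperator

/-! ### Estimates in terms of the repetitivity constant -/

theorem two_mul_le_two_pow {C : ℝ} (hC : 0 < C) {n : ℕ}
    (h : Real.log (2 * C) / Real.log 2 ≤ n) : 2 * C ≤ 2 ^ n := by
  rw [div_le_iff₀ (Real.log_pos one_lt_two), ← Real.log_pow] at h
  exact (Real.log_le_log_iff (by positivity) (by positivity)).1 h

theorem locallyIn_of_two_mul_le {ω₀ : Config Letter}
    (h : ω₀ ∈ ({omegaRB, omegaGY} : Set (Config Letter))) {n : ℕ} {C : ℝ}
    (hC : C ∈ repetitivityConstants tableSubshift) (hn : 2 * C ≤ 2 ^ n) {ω : Config Letter}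
    (hω : ω ∈ tableSubshift) :
    LocallyIn (2 ^ n / (2 * C)) (subst^[n] ω₀) ω ∧
      LocallyIn (2 ^ n / (2 * C)) ω (subst^[n] ω₀) := by
  have hC0 : 0 < 2 * C := by linarith [hC.1]
  refine ⟨locallyIn_tableSubshift (checkerboard_window_legal h) ?_ hω,
    locallyIn_subst hC ((one_le_div hC0).2 hn) (mul_div_cancel₀ _ hC0.ne').le hω⟩
  rw [mul_div_assoc', div_le_iff₀ hC0]
  nlinarith [hC.1, pow_pos (zero_lt_two' ℝ) n]

/-- Stated for any admissible $C$, so that the convergence of the orbits does not depend on the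
minimum being attained. -/
theorem hausdorffDist_orbit_subst_le {ω₀ : Config Letter}
    (h : ω₀ ∈ ({omegaRB, omegaGY} : Set (Config Letter))) {n : ℕ} {C : ℝ}
    (hC : C ∈ repetitivityConstants tableSubshift) (hn : 2 * C ≤ 2 ^ n) :
    Metric.hausdorffDist (subst^[n] ω₀).orbit tableSubshift ≤ max (2 * C) 4 / 2 ^ n := by
  have hC0 : 0 < 2 * C := by linarith [hC.1]
  have hr : 0 < 2 ^ n / (2 * C) := by positivity
  refine (hausdorffDist_orbit_le isSubshift_tableSubshift hr.le
    (fun ω hω => (locallyIn_of_two_mul_le h hC hn hω).2)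
    fun ω hω => (locallyIn_of_two_mul_le h hC hn hω).1).trans ?_
  calc 1 / (2 ^ n / (2 * C) + 1) ≤ 1 / (2 ^ n / (2 * C)) :=
        one_div_le_one_div_of_le hr (by linarith)
    _ = 2 * C / 2 ^ n := one_div_div _ _
    -- The argument gives $2C/2^n$; the maximum with 4 only weakens it.
    _ ≤ _ := by gcongr; exact le_max_left _ _

theorem tendsto_hausdorffDist_orbit_subst {ω₀ : Config Letter}
    (h : ω₀ ∈ ({omegaRB, omegaGY} : Set (Config Letter))) :
    Tendsto (fun n : ℕ => Metric.hausdorffDist (subst^[n] ω₀).orbit tableSubshift) atTop (𝓝 0) := by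
  obtain ⟨C, hC⟩ := repetitivityConstants_nonempty
  have hpow := tendsto_pow_atTop_atTop_of_one_lt (one_lt_two (α := ℝ))
  refine squeeze_zero' (Filter.Eventually.of_forall fun n => Metric.hausdorffDist_nonneg) ?_
    (hpow.const_div_atTop (max (2 * C) 4))
  filter_upwards [hpow.eventually_ge_atTop (2 * C)] with n hn
  exact hausdorffDist_orbit_subst_le h hC hn

theorem exists_hausdorffDist_spectrum_le {H : FiniteRangeOperator Letter}
    (hH : H.IsStronglyPatternEquivariant) :
    ∃ D : ℝ, 0 < D ∧ ∀ ω₀ ∈ ({omegaRB, omegaGY} : Set (Config Letter)), ∀ ω ∈ tableSubshift,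
      ∀ n : ℕ, ∀ C ∈ repetitivityConstants tableSubshift, 2 * C ≤ 2 ^ n →
        Metric.hausdorffDist (spectrum ℂ (H.op (subst^[n] ω₀))) (spectrum ℂ (H.op ω)) ≤
          D * (max (2 * C) 4 / 2 ^ n) := by
  obtain ⟨D, hD, hspec⟩ := FiniteRangeOperator.exists_spectrum_dist_le hH
  refine ⟨D, hD, fun ω₀ h ω hω n C hC hn => ?_⟩
  have hC0 : 0 < 2 * C := by linarith [hC.1]
  have hr : 1 ≤ 2 ^ n / (2 * C) := (one_le_div hC0).2 hn
  obtain ⟨h₁, h₂⟩ := locallyIn_of_two_mul_le h hC hn hω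
  have hle : D / (2 ^ n / (2 * C)) ≤ D * (max (2 * C) 4 / 2 ^ n) := by
    rw [div_div_eq_mul_div, mul_div_assoc]
    gcongr
    exact le_max_left _ _
  refine Metric.hausdorffDist_le_of_mem_dist (by positivity) (fun z hz => ?_) fun z hz => ?_
  · obtain ⟨w, hw, hd⟩ := hspec _ hr _ _ h₁ z hz
    exact ⟨w, hw, hd.trans hle⟩
  · obtain ⟨w, hw, hd⟩ := hspec _ hr _ _ h₂ z hz
    exact ⟨w, hw, hd.trans hle⟩

end TableTiling

theorem mainTheorem7 :
    TableTiling.IsSubshift TableTiling.tableSubshift ∧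
    TableTiling.IsPeriodicallyApproximable TableTiling.tableSubshift ∧
    TableTiling.omegaRB.orbit.ncard = 2 ∧
    TableTiling.omegaGY.orbit.ncard = 2 ∧
    (∀ ω₀ ∈ ({TableTiling.omegaRB, TableTiling.omegaGY} : Set (TableTiling.Config TableTiling.Letter)),
      (∀ n : ℕ, (TableTiling.subst^[n] ω₀).IsPeriodic) ∧
      Tendsto (fun n : ℕ => Metric.hausdorffDist (TableTiling.subst^[n] ω₀).orbit
        TableTiling.tableSubshift) atTop (𝓝 0)) ∧
    IsLeast (TableTiling.repetitivityConstants TableTiling.tableSubshift)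
      (TableTiling.linRepConst TableTiling.tableSubshift) ∧
    (∀ ω₀ ∈ ({TableTiling.omegaRB, TableTiling.omegaGY} : Set (TableTiling.Config TableTiling.Letter)),
      ∀ n : ℕ,
        Real.log (2 * TableTiling.linRepConst TableTiling.tableSubshift) / Real.log 2 ≤ n →
        Metric.hausdorffDist (TableTiling.subst^[n] ω₀).orbit TableTiling.tableSubshift ≤
          max (2 * TableTiling.linRepConst TableTiling.tableSubshift) 4 / 2 ^ n) ∧
    (∀ H : TableTiling.FiniteRangeOperator TableTiling.Letter, H.IsStronglyPatternEquivariant →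
      ∃ C : ℝ, 0 < C ∧
        ∀ ω₀ ∈ ({TableTiling.omegaRB, TableTiling.omegaGY} :
            Set (TableTiling.Config TableTiling.Letter)),
        ∀ ω ∈ TableTiling.tableSubshift, ∀ n : ℕ,
          Real.log (2 * TableTiling.linRepConst TableTiling.tableSubshift) / Real.log 2 ≤ n →
          Metric.hausdorffDist (spectrum ℂ (H.op (TableTiling.subst^[n] ω₀)))
              (spectrum ℂ (H.op ω)) ≤
            C * (max (2 * TableTiling.linRepConst TableTiling.tableSubshift) 4 / 2 ^ n)) := by
  have hleast := TableTiling.isLeast_linRepConst TableTiling.repetitivityConstants_nonempty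
  have hC0 : 0 < TableTiling.linRepConst TableTiling.tableSubshift :=
    zero_lt_one.trans_le hleast.1.1
  have hper : ∀ ω₀ ∈ ({TableTiling.omegaRB, TableTiling.omegaGY} :
      Set (TableTiling.Config TableTiling.Letter)), ∀ n : ℕ,
      (TableTiling.subst^[n] ω₀).IsPeriodic := by
    rintro ω₀ (rfl | rfl) n <;> exact TableTiling.checkerboard_subst_isPeriodic _ _ n
  refine ⟨TableTiling.isSubshift_tableSubshift,
    ⟨_, hper _ (Or.inl rfl), TableTiling.tendsto_hausdorffDist_orbit_subst (Or.inl rfl)⟩,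
    TableTiling.checkerboard_orbit_ncard (by simp),
    TableTiling.checkerboard_orbit_ncard (by simp),
    fun ω₀ h => ⟨hper ω₀ h, TableTiling.tendsto_hausdorffDist_orbit_subst h⟩, hleast,
    fun ω₀ h n hn => TableTiling.hausdorffDist_orbit_subst_le h hleast.1
      (TableTiling.two_mul_le_two_pow hC0 hn), fun H hH => ?_⟩
  obtain ⟨D, hD, hspec⟩ := TableTiling.exists_hausdorffDist_spectrum_le hH
  exact ⟨D, hD, fun ω₀ h ω hω n hn => hspec ω₀ h ω hω n _ hleast.1
    (TableTiling.two_mul_le_two_pow hC0 hn)⟩
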